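/- Let $\mathbf k$ be a field of characteristic zero and let $A=(a_1,\dots,a_n)=(a_{ij})$ be an integer $d\times n$ matrix of rank $d$ whose columns all lie on one hyperplane of $\mathbf Q^d$ off the origin. Let $D=\mathbf k\langle x_1,\dots,x_n,\partial_1,\dots,\partial_n\rangle$ be the Weyl algebra, put $\theta_j=x_j\partial_j$, and view $\mathbf k[s]=\mathbf k[s_1,\dots,s_d]$ as a subalgebra of $D$ via $s_i\mapsto\sum_j a_{ij}\theta_j$. Let $\mathbf NA$ and $\mathbf ZA$ be the monoid and the group generated by the columns of $A$. For $\chi\in\mathbf ZA$ define ideals of $\mathbf k[\partial]=\mathbf k[\partial_1,\dots,\partial_n]$ by $$I_A=\langle \partial^u-\partial^v \mid u,v\in\mathbf N^n,\ Au=Av\rangle,\qquad M_\chi=\langle\partial^u\mid u\in\mathbf N^n,\ Au\in\chi+\mathbf NA\rangle,\qquad I_\chi=I_A+M_\chi,$$ and the $b$-ideal $B_\chi=\mathbf k[s]\cap DI_\chi$, where $DI_\chi$ is the left ideal of $D$ generated by $I_\chi$. A standard pair of $M_\chi$ is a pair $(u,\tau)$ with $u\in\mathbf N^n$, $\tau\subset\{1,\dots,n\}$,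 such that $u_j=0$ for all $j\in\tau$; there is no $v\in\mathbf N^{\tau}$ with $\partial^{u+v}\in M_\chi$; and for each $j\notin\tau$ there is $v\in\mathbf N^{\tau\cup\{j\}}$ with $\partial^{u+v}\in M_\chi$. (Here $\mathbf N^{\tau}$ denotes the vectors of $\mathbf N^n$ supported in $\tau$.) Let $\mathcal S(M_\chi)$ be the set of standard pairs. In a pair $(u,\tau)$ we also write $\tau$ for the cone $\sum_{j\in\tau}\mathbf Q_{\ge0}a_j$, and $\mathbf k(A\cap\tau)$ for the $\mathbf k$-span in $\mathbf k^d$ of those $a_j$ that lie in this cone. A facet $\sigma$ is a $(d-1)$-dimensional face of the cone $\mathbf Q_{\ge0}A$ generated by the columns of $A$, and $F_\sigma$ is its primitive integral support function: the linear form with $F_\sigma(\mathbf ZA)=\mathbf Z$, $F_\sigma(a_j)\ge0$ for all $j$, and $F_\sigma(a_j)=0$ for all $a_j\in\sigma$. It is regarded as a linear polynomial in $\mathbf k[s]$. **Theorem.** 1. The set $\mathcal S(M_\chi)$ is finite, and $B_\chi$ has the (not necessarily irredundant) prime decomposition $$B_\chi=\bigcap_{(u,\tau)\in\mathcal S(M_\chi)}\langle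 F_\sigma-F_\sigma(Au)\mid \sigma \text{ a facet},\ \sigma\supset\tau\rangle ,$$ that is, the equality holds and each ideal on the right is prime. 2. The zero set $V(B_\chi)\subset\mathbf k^d$ has the (not necessarily irredundant) irreducible decomposition $$V(B_\chi)=\bigcup_{(u,\tau)\in\mathcal S(M_\chi)}\bigl(Au+\mathbf k(A\cap\tau)\bigr),$$ that is, the equality holds and each affine space on the right is irreducible in the Zariski topology of $\mathbf k^d$. -/

import Mathlib

open MvPolynomial Matrix

noncomputable section

/-! ### The Weyl algebra and its commutative subalgebras -/

/-- The defining relations of the Weyl algebra: the generator `Sum.inl i` is `x_i`, the generator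
`Sum.inr i` is `∂_i`. -/
inductive WeylRel (k : Type*) [Field k] (n : ℕ) :
    FreeAlgebra k (Fin n ⊕ Fin n) → FreeAlgebra k (Fin n ⊕ Fin n) → Prop
  | x_comm (i j : Fin n) : WeylRel k n
      (FreeAlgebra.ι k (Sum.inl i) * FreeAlgebra.ι k (Sum.inl j))
      (FreeAlgebra.ι k (Sum.inl j) * FreeAlgebra.ι k (Sum.inl i))
  | d_comm (i j : Fin n) : WeylRel k n
      (FreeAlgebra.ι k (Sum.inr i) * FreeAlgebra.ι k (Sum.inr j))
      (FreeAlgebra.ι k (Sum.inr j) * FreeAlgebra.ι k (Sum.inr i))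
  | d_x (i j : Fin n) : WeylRel k n
      (FreeAlgebra.ι k (Sum.inr i) * FreeAlgebra.ι k (Sum.inl j))
      (FreeAlgebra.ι k (Sum.inl j) * FreeAlgebra.ι k (Sum.inr i) + if i = j then 1 else 0)

/-- The Weyl algebra `D = k⟨x_1, …, x_n, ∂_1, …, ∂_n⟩`. -/
abbrev WeylAlgebra (k : Type*) [Field k] (n : ℕ) : Type _ := RingQuot (WeylRel k n)

namespace WeylAlgebra

variable (k : Type*) [Field k] {n : ℕ}

/-- The generator `x_i`. -/
def x (i : Fin n) : WeylAlgebra k n :=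
  RingQuot.mkAlgHom k (WeylRel k n) (FreeAlgebra.ι k (Sum.inl i))

/-- The generator `∂_i`. -/
def del (i : Fin n) : WeylAlgebra k n :=
  RingQuot.mkAlgHom k (WeylRel k n) (FreeAlgebra.ι k (Sum.inr i))

/-- The Euler operator `θ_i = x_i ∂_i`. -/
def theta (i : Fin n) : WeylAlgebra k n := x k i * del k i

theorem x_comm (i j : Fin n) : x k i * x k j = x k j * x k i := by
  simp only [x, ← map_mul]
  exact RingQuot.mkAlgHom_rel k (WeylRel.x_comm i j)

theorem del_comm (i j : Fin n) : del k i * del k j = del k j * del k i := by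
  simp only [del, ← map_mul]
  exact RingQuot.mkAlgHom_rel k (WeylRel.d_comm i j)

theorem del_x (i j : Fin n) :
    del k i * x k j = x k j * del k i + if i = j then 1 else 0 := by
  have h := RingQuot.mkAlgHom_rel k (WeylRel.d_x (k := k) i j)
  rw [map_mul, map_add, map_mul] at h
  simp only [x, del]
  rw [h]
  split_ifs <;> simp

theorem theta_comm (i j : Fin n) : theta k i * theta k j = theta k j * theta k i := by
  by_cases h : i = j
  · rw [h]
  · have e1 : del k i * x k j = x k j * del k i := by simpa [h] using del_x k i j
    have e2 : del k j * x k i = x k i * del k j := by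
      simpa [Ne.symm h] using del_x k j i
    calc theta k i * theta k j = x k i * (del k i * x k j) * del k j := by
          simp only [theta, mul_assoc]
      _ = x k i * x k j * (del k i * del k j) := by rw [e1]; simp only [mul_assoc]
      _ = x k j * x k i * (del k j * del k i) := by rw [x_comm, del_comm]
      _ = x k j * (del k j * x k i) * del k i := by rw [e2]; simp only [mul_assoc]
      _ = theta k j * theta k i := by simp only [theta, mul_assoc]

end WeylAlgebra

/-- Evaluation of commutative polynomials at pairwise commuting elements of a (noncommutative)
algebra: the algebra homomorphism that sends the variable `i` to `f i`. -/
def commAeval {k R ι : Type*} [Field k] [Ring R] [Algebra k R] (f : ι → R)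
    (hf : ∀ i j, f i * f j = f j * f i) : MvPolynomial ι k →ₐ[k] R :=
  letI : CommRing (Algebra.adjoin k (Set.range f)) :=
    { (Algebra.adjoin k (Set.range f)).toRing with
      mul_comm := fun a b => (Algebra.isMulCommutative_adjoin k (s := Set.range f) (by
        rintro _ ⟨i, rfl⟩ _ ⟨j, rfl⟩
        exact hf i j)).is_comm.comm a b }
  (Algebra.adjoin k (Set.range f)).val.comp
    (MvPolynomial.aeval fun i => ⟨f i, Algebra.subset_adjoin ⟨i, rfl⟩⟩)

theorem commAeval_X {k R ι : Type*} [Field k] [Ring R] [Algebra k R] (f : ι → R)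
    (hf : ∀ i j, f i * f j = f j * f i) (i : ι) : commAeval (k := k) f hf (X i) = f i := by
  simp [commAeval]

/-- The inclusion of `k[∂] = k[∂_1, …, ∂_n]` into the Weyl algebra. -/
def delHom (k : Type*) [Field k] (n : ℕ) : MvPolynomial (Fin n) k →ₐ[k] WeylAlgebra k n :=
  commAeval (WeylAlgebra.del k) (WeylAlgebra.del_comm k)

/-- The homogeneity operator `∑_j a_{ij} θ_j`. -/
def eulerOp (k : Type*) [Field k] {d n : ℕ} (A : Matrix (Fin d) (Fin n) ℤ) (i : Fin d) :
    WeylAlgebra k n :=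
  ∑ j, A i j • WeylAlgebra.theta k j

theorem eulerOp_comm (k : Type*) [Field k] {d n : ℕ} (A : Matrix (Fin d) (Fin n) ℤ)
    (i i' : Fin d) : eulerOp k A i * eulerOp k A i' = eulerOp k A i' * eulerOp k A i := by
  have h : Commute (eulerOp k A i) (eulerOp k A i') :=
    Commute.sum_left _ _ _ fun j _ => Commute.sum_right _ _ _ fun j' _ =>
      ((show Commute (WeylAlgebra.theta k j) (WeylAlgebra.theta k j') from
        WeylAlgebra.theta_comm k j j').smul_left _).smul_right _
  exact h

/-- The embedding of `k[s] = k[s_1, …, s_d]` into the Weyl algebra, `s_i ↦ ∑_j a_{ij} θ_j`. -/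
def sHom (k : Type*) [Field k] {d n : ℕ} (A : Matrix (Fin d) (Fin n) ℤ) :
    MvPolynomial (Fin d) k →ₐ[k] WeylAlgebra k n :=
  commAeval (eulerOp k A) (eulerOp_comm k A)

/-! ### The ideals `I_A`, `M_χ`, `I_χ` and the `b`-ideal `B_χ` -/

section Ideals

variable {d n : ℕ} (A : Matrix (Fin d) (Fin n) ℤ)

/-- The vector `Au` for `u ∈ ℕ^n`. -/
def mulNat (u : Fin n →₀ ℕ) : Fin d → ℤ := A *ᵥ fun j => (u j : ℤ)

/-- The monoid `ℕA` generated by the columns of `A`. -/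
def natSpan : AddSubmonoid (Fin d → ℤ) := AddSubmonoid.closure (Set.range fun j i => A i j)

/-- The lattice `ℤA` generated by the columns of `A`. -/
def intSpan : AddSubgroup (Fin d → ℤ) := AddSubgroup.closure (Set.range fun j i => A i j)

variable (k : Type*) [Field k]

/-- The toric ideal `I_A = ⟨∂^u - ∂^v : Au = Av⟩` of `k[∂]`. -/
def toricIdeal : Ideal (MvPolynomial (Fin n) k) :=
  Ideal.span {p | ∃ u v : Fin n →₀ ℕ, mulNat A u = mulNat A v ∧
    p = monomial u (1 : k) - monomial v (1 : k)}

/-- The monomial ideal `M_χ = ⟨∂^u : Au ∈ χ + ℕA⟩` of `k[∂]`. -/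
def monIdeal (χ : Fin d → ℤ) : Ideal (MvPolynomial (Fin n) k) :=
  Ideal.span {p | ∃ u : Fin n →₀ ℕ, (∃ w ∈ natSpan A, mulNat A u = χ + w) ∧
    p = monomial u (1 : k)}

/-- The left ideal `D I_χ` of the Weyl algebra generated by `I_χ = I_A + M_χ`. -/
def leftIdeal (χ : Fin d → ℤ) : Ideal (WeylAlgebra k n) :=
  Ideal.span (delHom k n '' (toricIdeal A k ⊔ monIdeal A k χ :
    Ideal (MvPolynomial (Fin n) k)))

/-- The `b`-ideal `B_χ = k[s] ∩ D I_χ`. -/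
def bIdeal (χ : Fin d → ℤ) : Ideal (MvPolynomial (Fin d) k) :=
  Ideal.comap (sHom k A) (leftIdeal A k χ)

end Ideals

/-! ### Standard pairs -/

/-- `(u, τ)` is a standard pair of the monomial ideal `M`. -/
structure IsStandardPair {k : Type*} [Field k] {n : ℕ} (M : Ideal (MvPolynomial (Fin n) k))
    (u : Fin n →₀ ℕ) (τ : Finset (Fin n)) : Prop where
  eq_zero : ∀ j ∈ τ, u j = 0
  notMem : ∀ v : Fin n →₀ ℕ, v.support ⊆ τ → monomial (u + v) (1 : k) ∉ M
  exists_mem : ∀ j ∉ τ, ∃ v : Fin n →₀ ℕ, v.support ⊆ insert j τ ∧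
    monomial (u + v) (1 : k) ∈ M

/-- The set of standard pairs of `M`. -/
def standardPairs {k : Type*} [Field k] {n : ℕ} (M : Ideal (MvPolynomial (Fin n) k)) :
    Set ((Fin n →₀ ℕ) × Finset (Fin n)) :=
  {p | IsStandardPair M p.1 p.2}

/-! ### The cone, its facets and their primitive integral support functions -/

section Cone

variable {d n : ℕ} (A : Matrix (Fin d) (Fin n) ℤ)

/-- The column `a_j`, as a vector over `ℚ`. -/
def ratCol (j : Fin n) : Fin d → ℚ := fun i => (A i j : ℚ)

/-- The cone `∑_{j ∈ τ} ℚ_{≥0} a_j`. -/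
def coneOf (τ : Finset (Fin n)) : PointedCone ℚ (Fin d → ℚ) :=
  PointedCone.hull ℚ (ratCol A '' τ)

/-- `σ` is a facet of the cone `ℚ_{≥0} A`: a face of dimension `d - 1`. -/
def IsFacet (σ : PointedCone ℚ (Fin d → ℚ)) : Prop :=
  σ.IsFaceOf (coneOf A Finset.univ) ∧
    Module.finrank ℚ (Submodule.span ℚ (σ : Set (Fin d → ℚ))) + 1 = d

/-- `F` is the primitive integral support function `F_σ` of the facet `σ`. -/
structure IsPrimitiveSupport (σ : PointedCone ℚ (Fin d → ℚ)) (F : (Fin d → ℚ) →ₗ[ℚ] ℚ) :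
    Prop where
  image_eq : (fun z : Fin d → ℤ => F fun i => (z i : ℚ)) '' (intSpan A : Set (Fin d → ℤ)) =
    Set.range fun m : ℤ => (m : ℚ)
  nonneg : ∀ j, 0 ≤ F (ratCol A j)
  eq_zero : ∀ j, ratCol A j ∈ σ → F (ratCol A j) = 0

variable (k : Type*) [Field k] [CharZero k]

/-- A rational linear form on `ℚ^d`, viewed as a linear polynomial in `k[s]`. -/
def formPoly (F : (Fin d → ℚ) →ₗ[ℚ] ℚ) : MvPolynomial (Fin d) k :=
  ∑ i, C ((F (Pi.single i 1) : ℚ) : k) * X i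

/-- The ideal `⟨F_σ - F_σ(Au) : σ a facet containing τ⟩` of `k[s]`; the index set `τ` stands for
the cone generated by the `a_j` with `j ∈ τ`. -/
def componentIdeal (u : Fin n →₀ ℕ) (τ : Finset (Fin n)) : Ideal (MvPolynomial (Fin d) k) :=
  Ideal.span {p | ∃ (σ : PointedCone ℚ (Fin d → ℚ)) (F : (Fin d → ℚ) →ₗ[ℚ] ℚ),
    IsFacet A σ ∧ coneOf A τ ≤ σ ∧ IsPrimitiveSupport A σ F ∧
    p = formPoly k F - C ((F fun i => (mulNat A u i : ℚ) : ℚ) : k)}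

/-- The `k`-linear space `k(A ∩ τ)` spanned by the `a_j` that lie in the cone of `τ`. -/
def linSpan (τ : Finset (Fin n)) : Submodule k (Fin d → k) :=
  Submodule.span k ((fun j i => (A i j : k)) '' {j | ratCol A j ∈ coneOf A τ})

/-- The affine space `Au + k(A ∩ τ)`. -/
def affinePiece (u : Fin n →₀ ℕ) (τ : Finset (Fin n)) : Set (Fin d → k) :=
  {β | ∃ w ∈ linSpan A k τ, β = (fun i => (mulNat A u i : k)) + w}

end Cone

/-- A subset of `k^d` is irreducible in the Zariski topology, whose closed sets are the zero loci
of ideals of `k[s]`. -/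
def IsZariskiIrreducible {k : Type*} [Field k] {d : ℕ} (V : Set (Fin d → k)) : Prop :=
  V.Nonempty ∧ ∀ I J : Ideal (MvPolynomial (Fin d) k),
    V ⊆ zeroLocus k I ∪ zeroLocus k J → V ⊆ zeroLocus k I ∨ V ⊆ zeroLocus k J

end

/-! The core is that `B_χ` consists of the polynomials vanishing at all points `Au` with `∂^u ∉ M_χ`
(`mem_bIdeal_iff`). For one inclusion, `f_β = ∑_{Av=β} x^v/v!` is a polynomial, since the hyperplane
condition makes the fibers finite. It satisfies `∂^w f_β = f_{β-Aw}`, and `p(s)` acts on it by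
`p(β)`. If `∂^u ∉ M_χ` and `β = Au`, then `D I_χ` kills `f_β ≠ 0`, so `p(β) = 0` for `p` in `B_χ`.
For the other, write `p(s)` as a combination of the operators `x^w ∂^w`, which act triangularly on
the `x^v/v!`. Vanishing at the points `Au` removes every term with `∂^w ∉ M_χ`, and the remaining
terms lie in `D M_χ`.

Standard pairs cover the standard exponents by sets `u + ℕ^τ`, and the Zariski closure of `Au +
A(ℕ^τ)` is the affine space `Au + k(A ∩ τ)`. What remains is convex geometry: the facets containing
`τ` must cut out exactly the span of `τ` (`mem_span_of_forall_facet_form`). By Farkas' lemma, a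
common zero of their forms lies in `ℚ_{≥0}A - ℚ_{≥0}τ`. Only columns on all these facets can occur
in it, and maximality in a standard pair forces such columns into `τ` (`mem_of_forall_facet_form`).
Hence each component ideal is the vanishing ideal of its affine space, and a linear retraction
(`exists_retraction`) shows that it is prime. -/

/-! ### The action of the Weyl algebra on polynomials -/

/-- Induction over `σ →₀ ℕ` from the unit vectors by addition. -/
theorem Finsupp.nat_induction_single_one {σ : Type*} {p : (σ →₀ ℕ) → Prop} (h0 : p 0)
    (h1 : ∀ j, p (Finsupp.single j 1)) (hadd : ∀ u v, p u → p v → p (u + v)) (u : σ →₀ ℕ) :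
    p u := by
  induction u using Finsupp.induction_linear with
  | zero => exact h0
  | add f g hf hg => exact hadd f g hf hg
  | single j m =>
    induction m with
    | zero => simpa using h0
    | succ m ih => rw [Finsupp.single_add]; exact hadd _ _ ih (h1 j)

namespace WeylAlgebra

variable (k : Type*) [Field k] {n : ℕ}

/-- The action of the Weyl algebra on `k[x]` by differential operators. -/
noncomputable def act (n : ℕ) :
    WeylAlgebra k n →ₐ[k] Module.End k (MvPolynomial (Fin n) k) :=
  RingQuot.liftAlgHom k ⟨FreeAlgebra.lift k (Sum.elim
    (fun i => LinearMap.mulLeft k (X i)) (fun i => (pderiv i).toLinearMap)), by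
    intro a b h
    induction h with
    | x_comm i j =>
      refine LinearMap.ext fun f => ?_
      simp [mul_left_comm]
    | d_comm i j =>
      refine LinearMap.ext fun f => ?_
      induction f using MvPolynomial.induction_on' with
      | add p q hp hq => rw [map_add, map_add, hp, hq]
      | monomial u a =>
        simp only [map_mul, FreeAlgebra.lift_ι_apply, Sum.elim_inr, Module.End.mul_apply,
          Derivation.coeFn_coe, pderiv_monomial]
        by_cases hij : i = j
        · rw [hij]
        · rw [tsub_right_comm]
          congr 1
          simp [hij, Ne.symm hij]
          ring
    | d_x i j =>
      refine LinearMap.ext fun f => ?_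
      by_cases hij : i = j
      · subst hij
        simp [Derivation.leibniz]
      · simp [Derivation.leibniz, hij, pderiv_X, Ne.symm hij]⟩

theorem act_x (i : Fin n) (f : MvPolynomial (Fin n) k) : act k n (x k i) f = X i * f := by
  simp [act, x]

theorem act_del (i : Fin n) (f : MvPolynomial (Fin n) k) :
    act k n (del k i) f = pderiv i f := by
  simp [act, del]

/-- The inclusion of `k[x]` into the Weyl algebra. -/
noncomputable def xHom (n : ℕ) : MvPolynomial (Fin n) k →ₐ[k] WeylAlgebra k n :=
  commAeval (x k) (x_comm k)

theorem act_xHom (q f : MvPolynomial (Fin n) k) : act k n (xHom k n q) f = q * f := by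
  induction q using MvPolynomial.induction_on generalizing f with
  | C a => simp [← MvPolynomial.algebraMap_eq, Algebra.smul_def]
  | add p q hp hq => simp [hp, hq, add_mul]
  | mul_X p i hp =>
    rw [map_mul, map_mul, Module.End.mul_apply, xHom, commAeval_X, act_x, ← xHom, hp, mul_assoc]

/-- The divided power `x^v / v!`. -/
noncomputable def dpow (v : Fin n →₀ ℕ) : MvPolynomial (Fin n) k :=
  monomial v (∏ j, ((v j).factorial : k))⁻¹

theorem prod_factorial_ne_zero [CharZero k] (v : Fin n →₀ ℕ) : (∏ j, ((v j).factorial : k)) ≠ 0 :=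
  Finset.prod_ne_zero_iff.2 fun _ _ => Nat.cast_ne_zero.2 (Nat.factorial_ne_zero _)

theorem pderiv_dpow_add_single [CharZero k] (j : Fin n) (v : Fin n →₀ ℕ) :
    pderiv j (dpow k (v + Finsupp.single j 1)) = dpow k v := by
  have h : (∏ i, ((v i + Finsupp.single j 1 i).factorial : k)) =
      (v j + 1 : k) * ∏ i, ((v i).factorial : k) := by
    rw [← Finset.mul_prod_erase _ _ (Finset.mem_univ j),
      ← Finset.mul_prod_erase Finset.univ (fun i => ((v i).factorial : k)) (Finset.mem_univ j),
      ← mul_assoc]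
    congr 1
    · simp [Nat.factorial_succ]
    · refine Finset.prod_congr rfl fun i hi => ?_
      simp [(Finset.ne_of_mem_erase hi).symm]
  have h1 : (v j + 1 : k) ≠ 0 := by exact_mod_cast (Nat.succ_ne_zero (v j))
  rw [dpow, pderiv_monomial, dpow]
  simp only [Finsupp.add_apply]
  rw [h]
  congr 1
  · simp
  · simp only [Finsupp.single_eq_same, Nat.cast_add, Nat.cast_one]
    have := prod_factorial_ne_zero k v
    field_simp

theorem pderiv_dpow [CharZero k] (j : Fin n) (v : Fin n →₀ ℕ) :
    pderiv j (dpow k v) =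
      if Finsupp.single j 1 ≤ v then dpow k (v - Finsupp.single j 1) else 0 := by
  split_ifs with h
  · conv_lhs => rw [← tsub_add_cancel_of_le h]
    exact pderiv_dpow_add_single k j _
  · have : v j = 0 := by simpa using h
    simp [dpow, pderiv_monomial, this]

/-- The factorials absorb all coefficients of differentiation, leaving a pure shift of exponents. -/
theorem act_delHom_monomial_dpow [CharZero k] (w v : Fin n →₀ ℕ) :
    act k n (delHom k n (monomial w 1)) (dpow k v) = if w ≤ v then dpow k (v - w) else 0 := by
  induction w using Finsupp.nat_induction_single_one generalizing v with
  | h0 => simp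
  | h1 j =>
    have : (monomial (Finsupp.single j 1) 1 : MvPolynomial (Fin n) k) = X j := rfl
    rw [this, delHom, commAeval_X, act_del, pderiv_dpow]
  | hadd u w hu hw =>
    have : (monomial (u + w) 1 : MvPolynomial (Fin n) k) = monomial u 1 * monomial w 1 := by simp
    rw [this, map_mul, map_mul, Module.End.mul_apply, hw]
    by_cases h : w ≤ v
    · rw [if_pos h, hu]
      simp only [le_tsub_iff_right h, tsub_tsub, add_comm w u]
    · rw [if_neg h, if_neg fun h' => h (le_trans le_add_self h'), map_zero]

theorem act_theta_dpow (j : Fin n) (v : Fin n →₀ ℕ) :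
    act k n (theta k j) (dpow k v) = (v j : k) • dpow k v := by
  rw [theta, map_mul, Module.End.mul_apply, act_del, act_x, dpow, pderiv_monomial]
  by_cases h : v j = 0
  · simp [h]
  · have h' : Finsupp.single j 1 ≤ v := by simpa [Nat.one_le_iff_ne_zero] using h
    rw [X, monomial_mul, add_tsub_cancel_of_le h', smul_monomial]
    simp [mul_comm]

theorem act_eulerOp_dpow {d : ℕ} (A : Matrix (Fin d) (Fin n) ℤ) (i : Fin d) (v : Fin n →₀ ℕ) :
    act k n (eulerOp k A i) (dpow k v) = (mulNat A v i : k) • dpow k v := by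
  have hz (a : ℤ) (P : WeylAlgebra k n) (f : MvPolynomial (Fin n) k) :
      act k n (a • P) f = (a : k) • act k n P f := by
    rw [map_zsmul, LinearMap.smul_apply, Int.cast_smul_eq_zsmul]
  simp only [eulerOp, map_sum, hz, LinearMap.sum_apply,
    act_theta_dpow, mulNat, Matrix.mulVec, dotProduct, Int.cast_sum, Int.cast_mul,
    Int.cast_natCast, Finset.sum_smul, smul_smul]

theorem act_sHom {d : ℕ} (A : Matrix (Fin d) (Fin n) ℤ) {f : MvPolynomial (Fin n) k}
    {β : Fin d → k} (hf : ∀ i, act k n (eulerOp k A i) f = β i • f) (p : MvPolynomial (Fin d) k) :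
    act k n (sHom k A p) f = eval β p • f := by
  induction p using MvPolynomial.induction_on with
  | C a => simp [← MvPolynomial.algebraMap_eq]
  | add p q hp hq => simp [hp, hq, add_smul]
  | mul_X p i hp =>
    rw [map_mul, map_mul, Module.End.mul_apply, sHom, commAeval_X, hf, ← sHom, map_smul, hp,
      map_mul, eval_X, smul_smul, mul_comm]

/-- The normally ordered monomial `x^w ∂^w`. -/
noncomputable def normMon (w : Fin n →₀ ℕ) : WeylAlgebra k n :=
  xHom k n (monomial w 1) * delHom k n (monomial w 1)

/-- The eigenvalue is `v!/(v-w)!`, nonzero in characteristic zero. With the next lemma this gives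
the triangularity of the operators `x^w ∂^w`. -/
theorem act_normMon_dpow_of_le [CharZero k] {w v : Fin n →₀ ℕ} (h : w ≤ v) :
    ∃ c : k, c ≠ 0 ∧ act k n (normMon k w) (dpow k v) = c • dpow k v := by
  refine ⟨(∏ j, ((v j).factorial : k)) * (∏ j, (((v - w) j).factorial : k))⁻¹,
    mul_ne_zero (prod_factorial_ne_zero k v) (inv_ne_zero (prod_factorial_ne_zero k _)), ?_⟩
  rw [normMon, map_mul, Module.End.mul_apply, act_delHom_monomial_dpow, if_pos h, act_xHom,
    dpow, dpow, monomial_mul, add_tsub_cancel_of_le h, smul_monomial]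
  congr 1
  have := prod_factorial_ne_zero k v
  rw [one_mul, smul_eq_mul]
  field_simp

theorem act_normMon_dpow_of_not_le [CharZero k] {w v : Fin n →₀ ℕ} (h : ¬ w ≤ v) :
    act k n (normMon k w) (dpow k v) = 0 := by
  rw [normMon, map_mul, Module.End.mul_apply, act_delHom_monomial_dpow, if_neg h, map_zero]

theorem delHom_monomial_mul_theta (w : Fin n →₀ ℕ) (j : Fin n) :
    delHom k n (monomial w 1) * theta k j =
      theta k j * delHom k n (monomial w 1) + (w j : k) • delHom k n (monomial w 1) := by
  induction w using Finsupp.nat_induction_single_one with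
  | h0 => simp
  | h1 i =>
    have : (monomial (Finsupp.single i 1) 1 : MvPolynomial (Fin n) k) = X i := rfl
    rw [this, delHom, commAeval_X, theta, ← mul_assoc, del_x, add_mul, mul_assoc, del_comm,
      ← mul_assoc]
    by_cases h : i = j
    · simp [h]
    · simp [h, Ne.symm h]
  | hadd u w hu hw =>
    have : (monomial (u + w) 1 : MvPolynomial (Fin n) k) = monomial u 1 * monomial w 1 := by simp
    rw [this, map_mul, mul_assoc, hw, mul_add, ← mul_assoc, hu, add_mul, mul_smul_comm,
      smul_mul_assoc, mul_assoc, add_assoc, ← add_smul, Finsupp.add_apply, Nat.cast_add]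

theorem normMon_mul_theta (w : Fin n →₀ ℕ) (j : Fin n) :
    normMon k w * theta k j = normMon k (w + Finsupp.single j 1) + (w j : k) • normMon k w := by
  have e (i) : (monomial (w + Finsupp.single j i) 1 : MvPolynomial (Fin n) k)
    = monomial w 1 * monomial (Finsupp.single j i) 1 := by simp
  have hX : (monomial (Finsupp.single j 1) 1 : MvPolynomial (Fin n) k) = X j := rfl
  have hx : xHom k n (X j) = x k j := commAeval_X _ _ _
  have hd : delHom k n (X j) = del k j := commAeval_X _ _ _
  rw [normMon, mul_assoc, delHom_monomial_mul_theta, mul_add, mul_smul_comm, normMon, e, hX,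
    map_mul (xHom k n), mul_comm (monomial w (1 : k)) (X j), map_mul (delHom k n), hx, hd, theta]
  simp only [mul_assoc]

/-- The span contains `1` and is stable under right multiplication by each `θ_j`, by
`normMon_mul_theta`. -/
theorem sHom_mem_span_normMon {d : ℕ} (A : Matrix (Fin d) (Fin n) ℤ)
    (p : MvPolynomial (Fin d) k) :
    sHom k A p ∈ Submodule.span k (Set.range (normMon k (n := n))) := by
  have key (P : WeylAlgebra k n) (j : Fin n)
      (hP : P ∈ Submodule.span k (Set.range (normMon k (n := n)))) :
      P * theta k j ∈ Submodule.span k (Set.range (normMon k (n := n))) := by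
    induction hP using Submodule.span_induction with
    | mem P hP =>
      obtain ⟨w, rfl⟩ := hP
      rw [normMon_mul_theta]
      exact add_mem (Submodule.subset_span ⟨_, rfl⟩)
        (Submodule.smul_mem _ _ (Submodule.subset_span ⟨_, rfl⟩))
    | zero => simp
    | add P Q _ _ hP hQ => rw [add_mul]; exact add_mem hP hQ
    | smul c P _ hP => rw [smul_mul_assoc]; exact Submodule.smul_mem _ _ hP
  induction p using MvPolynomial.induction_on with
  | C a =>
    rw [← MvPolynomial.algebraMap_eq, AlgHom.commutes, Algebra.algebraMap_eq_smul_one]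
    exact Submodule.smul_mem _ _ (Submodule.subset_span ⟨0, by simp [normMon]⟩)
  | add p q hp hq => rw [map_add]; exact add_mem hp hq
  | mul_X p i hp =>
    rw [map_mul, sHom, commAeval_X, ← sHom, eulerOp, Finset.mul_sum]
    refine Submodule.sum_mem _ fun j _ => ?_
    rw [mul_smul_comm]
    exact zsmul_mem (key _ j hp) _

end WeylAlgebra

/-! ### Monomial ideals and standard pairs -/

section StandardPairs

variable {k : Type*} [Field k] {n : ℕ} {M : Ideal (MvPolynomial (Fin n) k)}

theorem monomial_mem_of_le {u v : Fin n →₀ ℕ} (h : u ≤ v) (hu : monomial u (1 : k) ∈ M) :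
    monomial v (1 : k) ∈ M := by
  have : monomial v (1 : k) = monomial (v - u) 1 * monomial u 1 := by
    rw [monomial_mul, tsub_add_cancel_of_le h, one_mul]
  rw [this]
  exact M.mul_mem_left _ hu

/-- The exponents occurring in standard pairs are bounded. -/
theorem exists_standardPairs_bound (M : Ideal (MvPolynomial (Fin n) k)) :
    ∃ b : Fin n →₀ ℕ, ∀ p ∈ standardPairs M, p.1 ≤ b := by
  set S : Set (Fin n →₀ ℕ) := {u | monomial u (1 : k) ∈ M} with hS
  -- Dickson's lemma: `M` has finitely many minimal monomials. Their join bounds all `u`.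
  have hfin : {u | Minimal (· ∈ S) u}.Finite :=
    WellQuasiOrderedLE.finite_of_isAntichain (setOfPred_minimal_antichain _)
  refine ⟨hfin.toFinset.sup id, ?_⟩
  rintro ⟨u, τ⟩ hp j
  by_cases hj : j ∈ τ
  · simp [hp.eq_zero j hj]
  obtain ⟨v, hv, hmem⟩ := hp.exists_mem j hj
  obtain ⟨g, hgle, hg⟩ := exists_minimal_le_of_wellFoundedLT (· ∈ S) (u + v) hmem
  have hgb : g ≤ hfin.toFinset.sup id := Finset.le_sup (f := id) (by simpa using hg)
  refine le_trans ?_ (hgb j)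
  -- If `u j` exceeded `g j`, then `g` would still divide after the `j`-part of `v` is dropped,
  -- putting an element of `u + ℕ^τ` in `M`.
  by_contra! hlt
  refine hp.notMem (v.erase j) ?_ (monomial_mem_of_le ?_ hg.prop)
  · rw [Finsupp.support_erase]
    intro i hi
    rw [Finset.mem_erase] at hi
    exact (Finset.mem_insert.1 (hv hi.2)).resolve_left hi.1
  · intro i
    by_cases hij : i = j
    · subst hij
      simpa using hlt.le
    · simpa [hij] using hgle i

theorem standardPairs_finite (M : Ideal (MvPolynomial (Fin n) k)) : (standardPairs M).Finite := by
  obtain ⟨b, hb⟩ := exists_standardPairs_bound M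
  refine ((Set.finite_Icc 0 b).prod (Set.finite_univ (α := Finset (Fin n)))).subset ?_
  exact fun p hp => ⟨⟨zero_le, hb p hp⟩, Set.mem_univ _⟩

/-- Every standard monomial is covered by a standard pair. -/
theorem exists_standardPair_of_notMem {u : Fin n →₀ ℕ} (hu : monomial u (1 : k) ∉ M) :
    ∃ p ∈ standardPairs M, ∃ v : Fin n →₀ ℕ, v.support ⊆ p.2 ∧ u = p.1 + v := by
  classical
  -- `P τ` says that freeing the coordinates in `τ` never leads into `M`. It holds for `∅`, and a
  -- maximal such `τ` gives the standard pair.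
  let P : Finset (Fin n) → Prop := fun τ => ∀ v : Fin n →₀ ℕ, v.support ⊆ τ →
    monomial (u.filter (· ∉ τ) + v) (1 : k) ∉ M
  have hP : P ∅ := by
    intro v hv
    have hv0 : v = 0 := by simpa using hv
    have hf : u.filter (· ∉ (∅ : Finset (Fin n))) = u :=
      Finsupp.filter_eq_self_iff _ _ |>.2 fun i _ => Finset.notMem_empty i
    rwa [hv0, hf, add_zero]
  obtain ⟨τ, -, hτ⟩ := Set.Finite.exists_le_maximal (Set.toFinite {τ | P τ}) hP
  refine ⟨(u.filter (· ∉ τ), τ), ⟨fun j hj => by simp [hj], hτ.prop, fun j hj => ?_⟩,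
    u.filter (· ∈ τ), ?_, ?_⟩
  · have hn : ¬ P (insert j τ) := fun h =>
      hj (hτ.le_of_ge h (Finset.subset_insert j τ) (Finset.mem_insert_self j τ))
    simp only [P, not_forall, not_not] at hn
    obtain ⟨v, hv, hmem⟩ := hn
    refine ⟨v, hv, monomial_mem_of_le (add_le_add_left ?_ _) hmem⟩
    intro i
    simp only [Finsupp.filter_apply, Finset.mem_insert, not_or]
    split_ifs <;> simp_all
  · intro i
    simp
  · ext i
    simp only [Finsupp.add_apply, Finsupp.filter_apply]
    split_ifs <;> simp_all

end StandardPairs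

/-! ### Membership of monomials in `M_χ`. -/

section MonIdeal

variable {d n : ℕ} (A : Matrix (Fin d) (Fin n) ℤ)

theorem mulNat_zero : mulNat A 0 = 0 := by
  ext i; simp [mulNat, Matrix.mulVec, dotProduct]

theorem mulNat_add (u v : Fin n →₀ ℕ) : mulNat A (u + v) = mulNat A u + mulNat A v := by
  ext i; simp [mulNat, Matrix.mulVec, dotProduct, mul_add, Finset.sum_add_distrib]

theorem mulNat_single_one (j : Fin n) : mulNat A (Finsupp.single j 1) = fun i => A i j := by
  ext i
  simp [mulNat, Matrix.mulVec, dotProduct, Finsupp.single_apply]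

theorem mulNat_mem_natSpan (u : Fin n →₀ ℕ) : mulNat A u ∈ natSpan A := by
  induction u using Finsupp.nat_induction_single_one with
  | h0 => rw [mulNat_zero]; exact zero_mem _
  | h1 j => rw [mulNat_single_one]; exact AddSubmonoid.subset_closure ⟨j, rfl⟩
  | hadd u v hu hv => rw [mulNat_add]; exact add_mem hu hv

/-- The defining exponent set is already closed under adding `ℕ^n`. In particular, membership of
`∂^u` depends only on `Au`. -/
theorem monomial_mem_monIdeal_iff (k : Type*) [Field k] (χ : Fin d → ℤ) (u : Fin n →₀ ℕ) :
    monomial u (1 : k) ∈ monIdeal A k χ ↔ ∃ w ∈ natSpan A, mulNat A u = χ + w := by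
  have h : monIdeal A k χ = Ideal.span ((fun s => monomial s (1 : k)) ''
      {u | ∃ w ∈ natSpan A, mulNat A u = χ + w}) := by
    rw [monIdeal]
    congr 1
    ext p
    simp only [Set.mem_ofPred_eq, Set.mem_image, eq_comm]
  rw [h, mem_ideal_span_monomial_image]
  constructor
  · intro H
    obtain ⟨s, ⟨w, hw, e⟩, hs⟩ := H u (by simp)
    refine ⟨w + mulNat A (u - s), add_mem hw (mulNat_mem_natSpan A _), ?_⟩
    rw [← add_assoc, ← e, ← mulNat_add, add_tsub_cancel_of_le hs]
  · intro H v hv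
    have : v = u := by simpa using (Finset.mem_singleton.1 (support_monomial_subset hv))
    exact ⟨v, this ▸ H, le_rfl⟩

end MonIdeal

/-! ### The `b`-ideal as a vanishing ideal -/

namespace WeylAlgebra

variable (k : Type*) [Field k] {d n : ℕ} (A : Matrix (Fin d) (Fin n) ℤ)

/-- The form `h` takes the value `∑ v_j` at `Av`, so it bounds every entry of `v`. -/
theorem finite_mulNat_fiber {A : Matrix (Fin d) (Fin n) ℤ}
    (hplane : ∃ h : Fin d → ℚ, ∀ j, ∑ i, h i * (A i j : ℚ) = 1) (β : Fin d → ℤ) :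
    {v : Fin n →₀ ℕ | mulNat A v = β}.Finite := by
  obtain ⟨h, hh⟩ := hplane
  obtain ⟨N, hN⟩ := exists_nat_ge (∑ i, h i * (β i : ℚ))
  refine (Set.finite_Icc 0 (Finsupp.equivFunOnFinite.symm fun _ => N)).subset ?_
  rintro v rfl
  refine ⟨zero_le, fun j => ?_⟩
  have e : ∑ i, h i * (mulNat A v i : ℚ) = ∑ j, (v j : ℚ) := by
    calc ∑ i, h i * (mulNat A v i : ℚ) = ∑ i, ∑ j, h i * (A i j : ℚ) * v j := by
          simp [mulNat, Matrix.mulVec, dotProduct, Finset.mul_sum, mul_assoc]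
      _ = ∑ j, (∑ i, h i * (A i j : ℚ)) * v j := by
          rw [Finset.sum_comm]; simp [Finset.sum_mul]
      _ = ∑ j, (v j : ℚ) := by simp [hh]
  have h1 : (v j : ℚ) ≤ ∑ j, (v j : ℚ) :=
    Finset.single_le_sum (f := fun j => (v j : ℚ)) (fun _ _ => Nat.cast_nonneg _)
      (Finset.mem_univ j)
  rw [e] at hN
  exact_mod_cast h1.trans hN

/-- The polynomial solution `∑_{Av = β} x^v / v!` of the hypergeometric system with
parameter `β`. -/
noncomputable def fiberSum (β : Fin d → ℤ) : MvPolynomial (Fin n) k :=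
  ∑ᶠ v ∈ {v : Fin n →₀ ℕ | mulNat A v = β}, dpow k v

variable {A}

theorem fiberSum_eq (hplane : ∃ h : Fin d → ℚ, ∀ j, ∑ i, h i * (A i j : ℚ) = 1)
    (β : Fin d → ℤ) :
    fiberSum k A β = ∑ v ∈ (finite_mulNat_fiber hplane β).toFinset, dpow k v :=
  finsum_mem_eq_finite_toFinset_sum _ _

theorem act_eulerOp_fiberSum (hplane : ∃ h : Fin d → ℚ, ∀ j, ∑ i, h i * (A i j : ℚ) = 1)
    (β : Fin d → ℤ) (i : Fin d) :
    act k n (eulerOp k A i) (fiberSum k A β) = (β i : k) • fiberSum k A β := by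
  rw [fiberSum_eq k hplane, map_sum, Finset.smul_sum]
  refine Finset.sum_congr rfl fun v hv => ?_
  have : mulNat A v = β := by simpa using hv
  rw [act_eulerOp_dpow, this]

/-- Terms with `w ≰ v` die, and `v ↦ v - w` maps the others bijectively onto the fiber over `β -
Aw`. -/
theorem act_delHom_monomial_fiberSum [CharZero k]
    (hplane : ∃ h : Fin d → ℚ, ∀ j, ∑ i, h i * (A i j : ℚ) = 1)
    (β : Fin d → ℤ) (w : Fin n →₀ ℕ) :
    act k n (delHom k n (monomial w 1)) (fiberSum k A β) = fiberSum k A (β - mulNat A w) := by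
  classical
  rw [fiberSum_eq k hplane, fiberSum_eq k hplane, map_sum]
  simp only [act_delHom_monomial_dpow]
  rw [← Finset.sum_filter]
  refine Finset.sum_nbij' (· - w) (· + w) ?_ ?_ ?_ ?_ ?_
  · intro v hv
    simp only [Finset.mem_filter, Set.Finite.mem_toFinset, Set.mem_ofPred_eq] at hv ⊢
    rw [← hv.1, eq_sub_iff_add_eq, ← mulNat_add, tsub_add_cancel_of_le hv.2]
  · intro v hv
    simp only [Finset.mem_filter, Set.Finite.mem_toFinset, Set.mem_ofPred_eq] at hv ⊢
    exact ⟨by rw [mulNat_add, hv, sub_add_cancel], le_add_self⟩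
  · intro v hv
    exact tsub_add_cancel_of_le (Finset.mem_filter.1 hv).2
  · intro v _
    exact add_tsub_cancel_right v w
  · intro v _
    rfl

theorem fiberSum_mulNat_ne_zero [CharZero k]
    (hplane : ∃ h : Fin d → ℚ, ∀ j, ∑ i, h i * (A i j : ℚ) = 1) (u : Fin n →₀ ℕ) :
    fiberSum k A (mulNat A u) ≠ 0 := by
  classical
  intro h
  have h1 := congrArg (coeff u) h
  rw [fiberSum_eq k hplane, coeff_sum, Finset.sum_eq_single u] at h1
  · rw [dpow, coeff_monomial, if_pos rfl, coeff_zero] at h1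
    exact inv_ne_zero (prod_factorial_ne_zero k u) h1
  · intro v _ hv
    rw [dpow, coeff_monomial, if_neg hv]
  · intro hu
    simp at hu

theorem fiberSum_eq_zero {β : Fin d → ℤ} (h : β ∉ natSpan A) : fiberSum k A β = 0 := by
  rw [fiberSum]
  refine finsum_mem_eq_zero_of_forall_eq_zero fun v hv => ?_
  exact absurd (hv ▸ mulNat_mem_natSpan A v) h

/-- The left ideal of operators annihilating `f`. -/
noncomputable def annIdeal (f : MvPolynomial (Fin n) k) : Ideal (WeylAlgebra k n) where
  carrier := {P | act k n P f = 0}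
  zero_mem' := by simp
  add_mem' {P Q} hP hQ := by
    rw [Set.mem_ofPred_eq] at *
    rw [map_add, LinearMap.add_apply, hP, hQ, add_zero]
  smul_mem' P Q hQ := by
    rw [Set.mem_ofPred_eq] at *
    rw [smul_eq_mul, map_mul, Module.End.mul_apply, hQ, map_zero]

theorem mem_annIdeal {f : MvPolynomial (Fin n) k} {P : WeylAlgebra k n} :
    P ∈ annIdeal k f ↔ act k n P f = 0 := Iff.rfl

/-- The shift by `w` depends only on `Aw`, so toric binomials act as zero. A monomial of `M_χ`
shifts `β` out of `ℕA`, where the fiber is empty. -/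
theorem leftIdeal_le_annIdeal [CharZero k]
    (hplane : ∃ h : Fin d → ℚ, ∀ j, ∑ i, h i * (A i j : ℚ) = 1) {χ β : Fin d → ℤ}
    (hβ : ∀ w ∈ natSpan A, β ≠ χ + w) :
    leftIdeal A k χ ≤ annIdeal k (fiberSum k A β) := by
  rw [leftIdeal, Ideal.span_le, Set.image_subset_iff]
  change _ ≤ Ideal.comap (delHom k n) (annIdeal k (fiberSum k A β))
  refine sup_le (Ideal.span_le.2 ?_) (Ideal.span_le.2 ?_)
  · rintro p ⟨u, v, huv, rfl⟩
    rw [SetLike.mem_coe, Ideal.mem_comap, mem_annIdeal, map_sub, map_sub, LinearMap.sub_apply,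
      act_delHom_monomial_fiberSum k hplane, act_delHom_monomial_fiberSum k hplane, huv, sub_self]
  · rintro p ⟨u, ⟨w, hw, e⟩, rfl⟩
    rw [SetLike.mem_coe, Ideal.mem_comap, mem_annIdeal, act_delHom_monomial_fiberSum k hplane]
    refine fiberSum_eq_zero k fun hmem => hβ _ (add_mem hw hmem) ?_
    rw [e]
    abel

theorem eval_eq_zero_of_mem_bIdeal [CharZero k]
    (hplane : ∃ h : Fin d → ℚ, ∀ j, ∑ i, h i * (A i j : ℚ) = 1) {χ : Fin d → ℤ}
    {p : MvPolynomial (Fin d) k} (hp : p ∈ bIdeal A k χ) {u : Fin n →₀ ℕ}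
    (hu : monomial u (1 : k) ∉ monIdeal A k χ) : eval (fun i => (mulNat A u i : k)) p = 0 := by
  rw [monomial_mem_monIdeal_iff] at hu
  push Not at hu
  have h := leftIdeal_le_annIdeal k hplane hu hp
  rw [mem_annIdeal, act_sHom k A (act_eulerOp_fiberSum k hplane _)] at h
  exact (smul_eq_zero.1 h).resolve_right (fiberSum_mulNat_ne_zero k hplane u)

theorem mem_bIdeal_of_eval_eq_zero [CharZero k] {χ : Fin d → ℤ} {p : MvPolynomial (Fin d) k}
    (hp : ∀ u : Fin n →₀ ℕ, monomial u (1 : k) ∉ monIdeal A k χ →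
      eval (fun i => (mulNat A u i : k)) p = 0) : p ∈ bIdeal A k χ := by
  obtain ⟨c, hc⟩ := (Finsupp.mem_span_range_iff_exists_finsupp).1 (sHom_mem_span_normMon k A p)
  have hact (v : Fin n →₀ ℕ) : (c.sum fun w a => a • act k n (normMon k w) (dpow k v)) =
      eval (fun i => (mulNat A v i : k)) p • dpow k v := by
    rw [← act_sHom k A (fun i => act_eulerOp_dpow k A i v), ← hc, Finsupp.sum, Finsupp.sum,
      map_sum, LinearMap.sum_apply]
    simp
  -- Apply `p(s)` to `x^w/w!`: terms `v < w` vanish by induction, as divisors of standard monomials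
  -- are standard, and terms `v ≰ w` act by zero. Only a nonzero multiple of `c w` is left.
  have hzero (w : Fin n →₀ ℕ) : monomial w (1 : k) ∉ monIdeal A k χ → c w = 0 := by
    induction w using WellFoundedLT.induction with
    | ind w ih =>
      intro hw
      have h := hact w
      rw [hp w hw, zero_smul, Finsupp.sum, Finset.sum_eq_single w] at h
      · obtain ⟨b, hb, e⟩ := act_normMon_dpow_of_le k (le_refl w)
        rw [e, smul_smul] at h
        refine (mul_eq_zero.1 ((smul_eq_zero.1 h).resolve_right ?_)).resolve_right hb
        exact fun h0 => inv_ne_zero (prod_factorial_ne_zero k w) (monomial_eq_zero.1 h0)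
      · intro v _ hv
        by_cases hle : v ≤ w
        · rw [ih v (lt_of_le_of_ne hle hv) fun hmem => hw (monomial_mem_of_le hle hmem), zero_smul]
        · rw [act_normMon_dpow_of_not_le k hle, smul_zero]
      · intro hw0
        rw [Finsupp.notMem_support_iff.1 hw0, zero_smul]
  rw [bIdeal, Ideal.mem_comap, ← hc]
  refine Submodule.sum_mem _ fun w hw => ?_
  have hmem : monomial w (1 : k) ∈ monIdeal A k χ := by
    by_contra h
    exact (Finsupp.mem_support_iff.1 hw) (hzero w h)
  have h1 : normMon k w ∈ leftIdeal A k χ :=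
    Ideal.mul_mem_left _ _ (Ideal.subset_span ⟨_, Ideal.mem_sup_right hmem, rfl⟩)
  change c w • normMon k w ∈ leftIdeal A k χ
  rw [Algebra.smul_def]
  exact Ideal.mul_mem_left _ _ h1

theorem mem_bIdeal_iff [CharZero k]
    (hplane : ∃ h : Fin d → ℚ, ∀ j, ∑ i, h i * (A i j : ℚ) = 1) {χ : Fin d → ℤ}
    {p : MvPolynomial (Fin d) k} : p ∈ bIdeal A k χ ↔
      ∀ u : Fin n →₀ ℕ, monomial u (1 : k) ∉ monIdeal A k χ →
        eval (fun i => (mulNat A u i : k)) p = 0 :=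
  ⟨fun hp _ hu => eval_eq_zero_of_mem_bIdeal k hplane hp hu, mem_bIdeal_of_eval_eq_zero k⟩

end WeylAlgebra

/-! ### Finitely generated rational cones -/

section Farkas

variable {ι V : Type*} [AddCommGroup V] [Module ℚ V]

/-- Farkas' lemma over `ℚ`. -/
theorem exists_nonneg_combination_or_separating (s : Finset ι) (v : ι → V) (b : V) :
    (∃ c : ι → ℚ, (∀ i ∈ s, 0 ≤ c i) ∧ b = ∑ i ∈ s, c i • v i) ∨
      ∃ F : V →ₗ[ℚ] ℚ, (∀ i ∈ s, 0 ≤ F (v i)) ∧ F b < 0 := by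
  classical
  induction s using Finset.induction_on generalizing v b with
  | empty =>
    by_cases hb : b = 0
    · exact Or.inl ⟨0, by simp, by simp [hb]⟩
    · obtain ⟨F, hF⟩ : ∃ F : Module.Dual ℚ V, F b ≠ 0 := by
        by_contra! h
        exact hb ((Module.forall_dual_apply_eq_zero_iff ℚ b).1 h)
      rcases lt_or_gt_of_ne hF with h | h
      · exact Or.inr ⟨F, by simp, h⟩
      · exact Or.inr ⟨-F, by simp, by simpa using h⟩
  | insert o s ho ih =>
    rcases ih v b with ⟨c, hc, e⟩ | ⟨F, hF, hb⟩
    · refine Or.inl ⟨Function.update c o 0, fun i hi => ?_, ?_⟩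
      · by_cases h : i = o
        · simp [h]
        · simpa [h] using hc i (Finset.mem_of_mem_insert_of_ne hi h)
      · rw [Finset.sum_insert ho, Function.update_self, zero_smul, zero_add, e]
        exact Finset.sum_congr rfl fun i hi => by
          rw [Function.update_of_ne (ne_of_mem_of_not_mem hi ho)]
    · by_cases hFo : 0 ≤ F (v o)
      · exact Or.inr ⟨F, (Finset.forall_mem_insert _ _ _).2 ⟨hFo, hF⟩, hb⟩
      push Not at hFo
      have hne := hFo.ne
      -- `π` is the projection onto `ker F` along `v o`. A form separating the projected vectors
      -- pulls back to one vanishing at `v o`.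
      let π : V →ₗ[ℚ] V := LinearMap.id - (F (v o))⁻¹ • F.smulRight (v o)
      have hπ (x : V) : π x = x - ((F (v o))⁻¹ * F x) • v o := by
        simp [π, smul_smul]
      rcases ih (fun i => π (v i)) (π b) with ⟨c, hc, e⟩ | ⟨G, hG, hGb⟩
      -- Undoing the projection determines the coefficient of `v o`. It is nonnegative because `F b`
      -- and `F (v o)` are negative while `F (v i) ≥ 0`.
      · refine Or.inl ⟨Function.update c o
          ((F (v o))⁻¹ * F b - ∑ i ∈ s, c i * ((F (v o))⁻¹ * F (v i))), fun i hi => ?_, ?_⟩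
        · have hinv : (F (v o))⁻¹ < 0 := inv_lt_zero.2 hFo
          by_cases h : i = o
          · subst h
            rw [Function.update_self, sub_nonneg]
            refine le_trans (Finset.sum_nonpos fun j hj => ?_)
              (mul_pos_of_neg_of_neg hinv hb).le
            exact mul_nonpos_of_nonneg_of_nonpos (hc j hj)
              (mul_nonpos_of_nonpos_of_nonneg hinv.le (hF j hj))
          · simpa [h] using hc i (Finset.mem_of_mem_insert_of_ne hi h)
        · rw [Finset.sum_insert ho, Function.update_self]
          have h1 : ∑ i ∈ s, Function.update c o
              ((F (v o))⁻¹ * F b - ∑ i ∈ s, c i * ((F (v o))⁻¹ * F (v i))) i • v i =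
              ∑ i ∈ s, c i • v i :=
            Finset.sum_congr rfl fun i hi => by
              rw [Function.update_of_ne (ne_of_mem_of_not_mem hi ho)]
          rw [h1]
          simp only [hπ, smul_sub, Finset.sum_sub_distrib, smul_smul] at e
          rw [sub_smul, Finset.sum_smul]
          rw [sub_eq_iff_eq_add] at e
          exact e.trans (by abel)
      · refine Or.inr ⟨G.comp π, (Finset.forall_mem_insert _ _ _).2 ⟨?_, hG⟩, hGb⟩
        simp [hπ, inv_mul_cancel₀ hne]

variable [Finite ι]

/-- A form that is nonnegative on spanning vectors `a`, zero on those in `τ` and negative at `y`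
can be chosen to vanish on a hyperplane spanned by some of the `a`. -/
theorem exists_extremal_form {a : ι → V} (ha : Submodule.span ℚ (Set.range a) = ⊤)
    {τ : Finset ι} {y : V} {F : V →ₗ[ℚ] ℚ} (hF : ∀ j, 0 ≤ F (a j)) (hτ : ∀ j ∈ τ, F (a j) = 0)
    (hy : F y < 0) :
    ∃ G : V →ₗ[ℚ] ℚ, (∀ j, 0 ≤ G (a j)) ∧ (∀ j ∈ τ, G (a j) = 0) ∧ G y < 0 ∧
      Submodule.span ℚ (a '' {j | G (a j) = 0}) = LinearMap.ker G := by
  classical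
  -- Choose `G` with maximal zero set among the `a j`. If the zeros did not span `ker G`, a
  -- perturbation of `G` would have more of them.
  let P : Set ι → Prop := fun Z => ∃ G : V →ₗ[ℚ] ℚ, (∀ j, 0 ≤ G (a j)) ∧
    (∀ j ∈ τ, G (a j) = 0) ∧ G y < 0 ∧ Z = {j | G (a j) = 0}
  obtain ⟨Z, -, ⟨G, hG, hGτ, hGy, rfl⟩, hmax⟩ :=
    Set.Finite.exists_le_maximal (Set.toFinite {Z | P Z}) ⟨F, hF, hτ, hy, rfl⟩
  refine ⟨G, hG, hGτ, hGy, le_antisymm (Submodule.span_le.2 ?_) fun z hz => ?_⟩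
  · rintro _ ⟨j, hj, rfl⟩
    exact hj
  by_contra hzn
  obtain ⟨H, hHz, hH⟩ := Submodule.exists_le_ker_of_notMem hzn
  obtain ⟨K, hKy, hK, j₀, hj₀⟩ : ∃ K : V →ₗ[ℚ] ℚ, K y = 0 ∧
      (∀ j, G (a j) = 0 → K (a j) = 0) ∧ ∃ j, K (a j) < 0 := by
    set K := H - (H y / G y) • G with hKdef
    have hKy : K y = 0 := by
      simp [hKdef, div_mul_cancel₀ _ hGy.ne]
    have hK : ∀ j, G (a j) = 0 → K (a j) = 0 := by
      intro j hj
      have : H (a j) = 0 := hH (Submodule.subset_span ⟨j, hj, rfl⟩)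
      simp [hKdef, hj, this]
    have hne : ∃ j, K (a j) ≠ 0 := by
      by_contra! h
      have h0 : K = 0 := LinearMap.ext_on_range ha (by simpa using h)
      have hz' : G z = 0 := hz
      have : K z = H z := by simp [hKdef, hz']
      rw [h0] at this
      exact hHz this.symm
    obtain ⟨j, hj⟩ := hne
    rcases lt_or_gt_of_ne hj with h | h
    · exact ⟨K, hKy, hK, j, h⟩
    · exact ⟨-K, by simp [hKy], fun i hi => by simp [hK i hi], j, by simpa using h⟩
  cases nonempty_fintype ι
  obtain ⟨j, hj, hmin⟩ := Finset.exists_min_image (Finset.univ.filter fun j => K (a j) < 0)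
    (fun j => G (a j) / -K (a j)) ⟨j₀, by simpa using hj₀⟩
  have hjneg : K (a j) < 0 := by simpa using hj
  -- The first `t` at which `G + t • K` acquires a new zero among the `a j`. Nonnegativity persists
  -- up to it, and the value at `y` is unchanged since `K y = 0`.
  set t := G (a j) / -K (a j) with ht
  have ht0 : 0 ≤ t := div_nonneg (hG j) (by linarith)
  have hj0 : (G + t • K) (a j) = 0 := by
    have : K (a j) ≠ 0 := hjneg.ne
    simp only [LinearMap.add_apply, LinearMap.smul_apply, smul_eq_mul, ht]
    field_simp
    ring
  have hsub : {j | G (a j) = 0} ⊆ {j | (G + t • K) (a j) = 0} := by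
    intro i hi
    have hi' : G (a i) = 0 := hi
    simp [hi', hK i hi']
  have hmem := hmax (y := {j | (G + t • K) (a j) = 0}) ⟨G + t • K, fun i => ?_, fun i hi =>
    hsub (hGτ i hi), by simpa [hKy] using hGy, rfl⟩ hsub hj0
  · exact hjneg.ne (hK j hmem)
  · simp only [LinearMap.add_apply, LinearMap.smul_apply, smul_eq_mul]
    by_cases hi : K (a i) < 0
    · have := hmin i (by simpa using hi)
      rw [le_div_iff₀ (by linarith)] at this
      linarith
    · have := hG i
      have := mul_nonneg ht0 (not_lt.1 hi)
      linarith

end Farkas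

/-! ### Facets of the cone and their primitive support functions. -/

section Facets

variable {d n : ℕ} {A : Matrix (Fin d) (Fin n) ℤ}

theorem span_ratCol_eq_top (hrank : (A.map (Int.cast : ℤ → ℚ)).rank = d) :
    Submodule.span ℚ (Set.range (ratCol A)) = ⊤ := by
  apply Submodule.eq_top_of_finrank_eq
  rw [Matrix.rank_eq_finrank_span_cols] at hrank
  rw [Module.finrank_fin_fun]
  exact hrank

theorem coneOf_le_span (τ : Finset (Fin n)) {x : Fin d → ℚ} (hx : x ∈ coneOf A τ) :
    x ∈ Submodule.span ℚ (ratCol A '' τ) :=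
  PointedCone.hull_le_span (R := ℚ) _ hx

theorem ratCol_mem_coneOf {τ : Finset (Fin n)} {j : Fin n} (hj : j ∈ τ) :
    ratCol A j ∈ coneOf A τ :=
  PointedCone.subset_hull ⟨j, hj, rfl⟩

theorem coneOf_mono {τ τ' : Finset (Fin n)} (h : τ ⊆ τ') : coneOf A τ ≤ coneOf A τ' :=
  Submodule.span_mono (Set.image_mono (by exact_mod_cast h))

theorem span_coneOf (τ : Finset (Fin n)) :
    Submodule.span ℚ (coneOf A τ : Set (Fin d → ℚ)) = Submodule.span ℚ (ratCol A '' τ) :=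
  le_antisymm (Submodule.span_le.2 fun _ hx => coneOf_le_span τ hx)
    (Submodule.span_mono PointedCone.subset_hull)

theorem eq_zero_of_mem_coneOf {τ : Finset (Fin n)} {G : (Fin d → ℚ) →ₗ[ℚ] ℚ}
    (hG : ∀ j ∈ τ, G (ratCol A j) = 0) {x : Fin d → ℚ} (hx : x ∈ coneOf A τ) : G x = 0 := by
  have h : Submodule.span ℚ (ratCol A '' τ) ≤ LinearMap.ker G := by
    rw [Submodule.span_le]
    rintro _ ⟨j, hj, rfl⟩
    exact hG j hj
  exact h (coneOf_le_span τ hx)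

/-- The face of `ℚ_{≥0} A` cut out by a nonnegative form. -/
theorem isFaceOf_coneOf_filter {G : (Fin d → ℚ) →ₗ[ℚ] ℚ} (hG : ∀ j, 0 ≤ G (ratCol A j)) :
    (coneOf A (Finset.univ.filter fun j => G (ratCol A j) = 0)).IsFaceOf
      (coneOf A Finset.univ) := by
  have key : ∀ x ∈ coneOf A Finset.univ, 0 ≤ G x ∧
      (G x = 0 → x ∈ coneOf A (Finset.univ.filter fun j => G (ratCol A j) = 0)) := by
    intro x hx
    induction hx using Submodule.span_induction with
    | mem x hx =>
      obtain ⟨j, -, rfl⟩ := hx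
      exact ⟨hG j, fun h => ratCol_mem_coneOf (by simpa using h)⟩
    | zero => exact ⟨by simp, fun _ => zero_mem _⟩
    | add x y _ _ hx hy =>
      rw [map_add]
      refine ⟨add_nonneg hx.1 hy.1, fun h => ?_⟩
      have := (add_eq_zero_iff_of_nonneg hx.1 hy.1).1 h
      exact add_mem (hx.2 this.1) (hy.2 this.2)
    | smul r x _ hx =>
      have e : G (r • x) = (r : ℚ) * G x := by
        rw [← smul_eq_mul, ← map_smul]; rfl
      rw [e]
      refine ⟨mul_nonneg r.2 hx.1, fun h => ?_⟩
      rcases mul_eq_zero.1 h with h | h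
      · have : r = 0 := Subtype.ext h
        rw [this, zero_smul]
        exact zero_mem _
      · exact Submodule.smul_mem _ _ (hx.2 h)
  refine ⟨coneOf_mono (Finset.subset_univ _), fun {x y r} hx hy hr h => (key x hx).2 ?_⟩
  have h0 := eq_zero_of_mem_coneOf (G := G) (by simp) h
  rw [map_add, map_smul, smul_eq_mul] at h0
  have := (add_eq_zero_iff_of_nonneg (mul_nonneg hr.le (key x hx).1) (key y hy).1).1 h0
  exact (mul_eq_zero.1 this.1).resolve_left hr.ne'

/-- A nonzero form can be rescaled so that it maps `ℤA` onto `ℤ`. -/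
theorem exists_pos_smul_image_intSpan {G : (Fin d → ℚ) →ₗ[ℚ] ℚ}
    (hG : ∃ j, G (ratCol A j) ≠ 0) : ∃ c : ℚ, 0 < c ∧
      (fun z : Fin d → ℤ => (c • G) fun i => (z i : ℚ)) '' (intSpan A : Set (Fin d → ℤ)) =
        Set.range fun m : ℤ => (m : ℚ) := by
  obtain ⟨N, hN⟩ := IsLocalization.exist_integer_multiples (nonZeroDivisors ℤ)
    (Finset.univ : Finset (Fin d)) fun i => G (Pi.single i 1)
  choose! m hm using fun i => hN i (Finset.mem_univ i)
  have hN0 : (N : ℤ) ≠ 0 := nonZeroDivisors.coe_ne_zero N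
  let φ : (Fin d → ℤ) →+ ℤ :=
    { toFun := fun z => ∑ i, z i * m i
      map_zero' := by simp
      map_add' := fun x y => by simp [add_mul, Finset.sum_add_distrib] }
  have hφ (z : Fin d → ℤ) : (φ z : ℚ) = (N : ℤ) * G fun i => (z i : ℚ) := by
    have e : (fun i => (z i : ℚ)) = ∑ i, (z i : ℚ) • (Pi.single i 1 : Fin d → ℚ) := by
      ext i
      simp [Finset.sum_apply, Pi.single_apply]
    rw [e, map_sum, Finset.mul_sum]
    simp only [φ, AddMonoidHom.coe_mk, ZeroHom.coe_mk, Int.cast_sum, Int.cast_mul, map_smul,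
      smul_eq_mul]
    refine Finset.sum_congr rfl fun i _ => ?_
    have := hm i
    simp only [algebraMap_int_eq, eq_intCast, zsmul_eq_mul] at this
    rw [this]
    ring
  -- After clearing denominators by `N`, the image of `ℤA` is `gℤ`, so `G` must be scaled by
  -- `|N/g|`.
  obtain ⟨g, hg⟩ := Int.subgroup_cyclic (AddSubgroup.map φ (intSpan A))
  rw [← AddSubgroup.zmultiples_eq_closure] at hg
  have hg0 : g ≠ 0 := by
    rintro rfl
    obtain ⟨j, hj⟩ := hG
    have h1 : φ (fun i => A i j) ∈ AddSubgroup.map φ (intSpan A) :=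
      ⟨_, AddSubgroup.subset_closure ⟨j, rfl⟩, rfl⟩
    rw [hg] at h1
    have h2 : φ (fun i => A i j) = 0 := by simpa using h1
    have h3 := hφ fun i => A i j
    rw [h2, Int.cast_zero, eq_comm, mul_eq_zero] at h3
    exact hj (h3.resolve_left (by exact_mod_cast hN0))
  have hgq : (g : ℚ) ≠ 0 := by exact_mod_cast hg0
  have hNq : ((N : ℤ) : ℚ) ≠ 0 := by exact_mod_cast hN0
  set q : ℚ := (N : ℤ) / g with hq
  -- The sign `ε` makes the factor positive, so that scaling preserves nonnegativity on the cone.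
  obtain ⟨ε, hε, hεq⟩ : ∃ ε : ℤ, ε * ε = 1 ∧ |q| = ε * q := by
    rcases abs_choice q with h | h
    · exact ⟨1, by norm_num, by rw [h]; simp⟩
    · exact ⟨-1, by norm_num, by rw [h]; simp⟩
  refine ⟨|q|, abs_pos.2 (div_ne_zero hNq hgq), ?_⟩
  have hval (z : Fin d → ℤ) {t : ℤ} (ht : φ z = t * g) :
      (|q| • G) (fun i => (z i : ℚ)) = (ε * t : ℤ) := by
    have h := hφ z
    rw [ht] at h
    push_cast at h
    rw [LinearMap.smul_apply, hεq, smul_eq_mul, hq, Int.cast_mul]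
    field_simp
    linear_combination -(ε : ℚ) * h
  ext x
  constructor
  · rintro ⟨z, hz, rfl⟩
    have h1 : φ z ∈ AddSubgroup.map φ (intSpan A) := ⟨z, hz, rfl⟩
    rw [hg, AddSubgroup.mem_zmultiples_iff] at h1
    obtain ⟨t, ht⟩ := h1
    exact ⟨ε * t, (hval z (by rw [← ht, smul_eq_mul])).symm⟩
  · rintro ⟨m, rfl⟩
    have h1 : (ε * m) * g ∈ AddSubgroup.map φ (intSpan A) := by
      rw [hg]
      exact AddSubgroup.mem_zmultiples_iff.2 ⟨ε * m, smul_eq_mul _ _⟩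
    obtain ⟨z, hz, e⟩ := h1
    exact ⟨z, hz, (hval z e).trans (by rw [← mul_assoc, hε, one_mul])⟩

/-- Apply Farkas' lemma to the columns together with the negatives of those in `τ`: a separating
form is nonnegative on the cone and zero on `τ`. Making it extremal turns its zero face into a
facet. -/
theorem exists_facet_form_neg (hrank : (A.map (Int.cast : ℤ → ℚ)).rank = d)
    {τ : Finset (Fin n)} {y : Fin d → ℚ}
    (hy : ¬ ∃ c e : Fin n → ℚ, (∀ j, 0 ≤ c j) ∧ (∀ j ∈ τ, 0 ≤ e j) ∧
      y = ∑ j, c j • ratCol A j - ∑ j ∈ τ, e j • ratCol A j) :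
    ∃ (σ : PointedCone ℚ (Fin d → ℚ)) (F : (Fin d → ℚ) →ₗ[ℚ] ℚ),
      IsFacet A σ ∧ coneOf A τ ≤ σ ∧ IsPrimitiveSupport A σ F ∧ F y < 0 := by
  have hspan := span_ratCol_eq_top hrank
  rcases exists_nonneg_combination_or_separating (Finset.univ.disjSum τ)
    (Sum.elim (ratCol A) (fun j => -ratCol A j)) y with ⟨c, hc, e⟩ | ⟨F, hF, hFy⟩
  · refine absurd ⟨fun j => c (Sum.inl j), fun j => c (Sum.inr j), fun j => hc _ ?_,
      fun j hj => hc _ (Finset.inr_mem_disjSum.2 hj), ?_⟩ hy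
    · exact Finset.inl_mem_disjSum.2 (Finset.mem_univ j)
    · rw [e, Finset.sum_disjSum]
      simp [sub_eq_add_neg]
  have hF0 : ∀ j, 0 ≤ F (ratCol A j) := fun j =>
    hF (Sum.inl j) (Finset.inl_mem_disjSum.2 (Finset.mem_univ j))
  have hFτ : ∀ j ∈ τ, F (ratCol A j) = 0 := fun j hj => le_antisymm
    (by simpa using hF (Sum.inr j) (Finset.inr_mem_disjSum.2 hj)) (hF0 j)
  obtain ⟨G, hG, hGτ, hGy, hGker⟩ := exists_extremal_form hspan hF0 hFτ hFy
  have hG0 : G ≠ 0 := by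
    rintro rfl
    simp at hGy
  have hne : ∃ j, G (ratCol A j) ≠ 0 := by
    by_contra! h
    exact hG0 (LinearMap.ext_on_range hspan (by simpa using h))
  obtain ⟨c, hc, himage⟩ := exists_pos_smul_image_intSpan hne
  refine ⟨coneOf A (Finset.univ.filter fun j => G (ratCol A j) = 0), c • G,
    ⟨isFaceOf_coneOf_filter hG, ?_⟩, coneOf_mono fun j hj => by simpa using hGτ j hj,
    ⟨himage, fun j => mul_nonneg hc.le (hG j), fun j hj => ?_⟩, mul_neg_of_pos_of_neg hc hGy⟩
  · have hcoe : ((Finset.univ.filter fun j => G (ratCol A j) = 0 : Finset (Fin n)) :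
        Set (Fin n)) = {j | G (ratCol A j) = 0} := by
      ext j
      simp
    rw [span_coneOf, hcoe, hGker, Module.Dual.finrank_ker_add_one_of_ne_zero hG0]
    simp
  · have := eq_zero_of_mem_coneOf (G := G) (by simp) hj
    simp [this]

theorem exists_nat_mul_eq_natCast {ι : Type*} (s : Finset ι) (c : ι → ℚ)
    (hc : ∀ i ∈ s, 0 ≤ c i) :
    ∃ N : ℕ, 0 < N ∧ ∃ m : ι → ℕ, ∀ i ∈ s, (N : ℚ) * c i = m i := by
  classical
  refine ⟨∏ i ∈ s, (c i).den, Finset.prod_pos fun i _ => (c i).den_pos,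
    fun i => (∏ j ∈ s.erase i, (c j).den) * (c i).num.toNat, fun i hi => ?_⟩
  have h1 : ((c i).num.toNat : ℚ) = (c i).den * c i := by
    have h2 : (((c i).num.toNat : ℤ) : ℚ) = (c i).num := by
      rw [Int.toNat_of_nonneg (Rat.num_nonneg.2 (hc i hi))]
    rw [Rat.den_mul_eq_num, ← h2, Int.cast_natCast]
  rw [← Finset.mul_prod_erase s _ hi, Nat.cast_mul, Nat.cast_mul, h1]
  ring

theorem ratCast_mulNat (u : Fin n →₀ ℕ) :
    (fun i => (mulNat A u i : ℚ)) = ∑ j, (u j : ℚ) • ratCol A j := by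
  ext i
  simp [mulNat, Matrix.mulVec, dotProduct, ratCol, mul_comm]

/-- By Farkas, `-a_j` lies in `ℚ_{≥0}A - ℚ_{≥0}τ`, so `AE = N a_j + AC` with `N > 0` and `E ∈ ℕ^τ`.
If `j ∉ τ`, each factor `∂_j` in a monomial of `M_χ` could be traded for `∂^E`, giving an element of
`u + ℕ^τ` in `M_χ`. -/
theorem mem_of_forall_facet_form (hrank : (A.map (Int.cast : ℤ → ℚ)).rank = d)
    {k : Type*} [Field k] {χ : Fin d → ℤ} {u : Fin n →₀ ℕ} {τ : Finset (Fin n)}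
    (hp : IsStandardPair (monIdeal A k χ) u τ) {j : Fin n}
    (hj : ∀ (σ : PointedCone ℚ (Fin d → ℚ)) (F : (Fin d → ℚ) →ₗ[ℚ] ℚ),
      IsFacet A σ → coneOf A τ ≤ σ → IsPrimitiveSupport A σ F → F (ratCol A j) = 0) :
    j ∈ τ := by
  classical
  by_contra hjτ
  obtain ⟨c, e, hc, he, heq⟩ : ∃ c e : Fin n → ℚ, (∀ j, 0 ≤ c j) ∧ (∀ j ∈ τ, 0 ≤ e j) ∧
      -ratCol A j = ∑ j, c j • ratCol A j - ∑ j ∈ τ, e j • ratCol A j := by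
    by_contra h
    obtain ⟨σ, F, hσ, hτσ, hF, hneg⟩ := exists_facet_form_neg hrank h
    rw [map_neg, hj σ F hσ hτσ hF] at hneg
    simp at hneg
  obtain ⟨N, hN, m, hm⟩ := exists_nat_mul_eq_natCast (Finset.univ.disjSum τ) (Sum.elim c e) (by
    rintro (i | i) hi
    · exact hc i
    · exact he i (Finset.inr_mem_disjSum.1 hi))
  let C : Fin n →₀ ℕ := Finsupp.equivFunOnFinite.symm fun i => m (Sum.inl i)
  let E : Fin n →₀ ℕ := Finsupp.equivFunOnFinite.symm fun i => if i ∈ τ then m (Sum.inr i) else 0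
  have hE : E.support ⊆ τ := by
    intro i hi
    by_contra h
    simp [E, h] at hi
  have hmul : mulNat A E = N • mulNat A (Finsupp.single j 1) + mulNat A C := by
    have h1 : (fun i => (mulNat A E i : ℚ)) =
        (N : ℚ) • (fun i => (mulNat A (Finsupp.single j 1) i : ℚ)) + fun i => (mulNat A C i : ℚ) := by
      have hs : ∑ i, ((Finsupp.single j 1 : Fin n →₀ ℕ) i : ℚ) • ratCol A i = ratCol A j := by
        rw [Finset.sum_eq_single j]
        · simp
        · intro i _ hi
          simp [hi]
        · simp
      have hC : ∑ i, (C i : ℚ) • ratCol A i = (N : ℚ) • ∑ i, c i • ratCol A i := by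
        rw [Finset.smul_sum]
        refine Finset.sum_congr rfl fun i _ => ?_
        rw [smul_smul, show (N : ℚ) * c i = C i from
          hm (Sum.inl i) (Finset.inl_mem_disjSum.2 (Finset.mem_univ i))]
      have hE' : ∑ i, (E i : ℚ) • ratCol A i = (N : ℚ) • ∑ i ∈ τ, e i • ratCol A i := by
        rw [Finset.smul_sum, ← Finset.sum_subset (Finset.subset_univ τ)]
        · refine Finset.sum_congr rfl fun i hi => ?_
          rw [smul_smul, show (N : ℚ) * e i = m (Sum.inr i) from
            hm (Sum.inr i) (Finset.inr_mem_disjSum.2 hi)]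
          simp [E, hi]
        · intro i _ hi
          simp [E, hi]
      rw [ratCast_mulNat, ratCast_mulNat, ratCast_mulNat, hs, hC, hE', ← smul_add]
      congr 1
      rw [← sub_eq_zero] at heq ⊢
      rw [← heq]
      abel
    ext i
    have h2 := congrFun h1 i
    simp only [Pi.add_apply, Pi.smul_apply, smul_eq_mul] at h2
    simp only [Pi.add_apply, nsmul_eq_mul]
    exact_mod_cast h2
  obtain ⟨v, hv, hmem⟩ := hp.exists_mem j hjτ
  have hnsmul (a : ℕ) (w : Fin n →₀ ℕ) : mulNat A (a • w) = a • mulNat A w := by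
    induction a with
    | zero => simp [mulNat_zero]
    | succ a ih => rw [succ_nsmul, mulNat_add, ih, succ_nsmul]
  refine hp.notMem (v.erase j + v j • E) (fun i hi => ?_) ?_
  · rcases Finset.mem_union.1 (Finsupp.support_add hi) with h | h
    · rw [Finsupp.support_erase, Finset.mem_erase] at h
      exact (Finset.mem_insert.1 (hv h.2)).resolve_left h.1
    · exact hE (Finsupp.support_smul h)
  -- This multiple of `∂^(u+v)` has the same image under `A` as the traded monomial.
  · have h1 : monomial (u + v + (((N - 1) * v j) • Finsupp.single j 1 + v j • C)) (1 : k) ∈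
        monIdeal A k χ := monomial_mem_of_le le_self_add hmem
    rw [monomial_mem_monIdeal_iff] at h1 ⊢
    convert h1 using 4
    have hv' : v = v.erase j + v j • Finsupp.single j 1 := by
      ext i
      by_cases h : i = j
      · subst h; simp
      · simp [h, Finsupp.erase_ne h]
    obtain ⟨N, rfl⟩ : ∃ N', N = N' + 1 := ⟨N - 1, by omega⟩
    have hv2 : mulNat A v = mulNat A (v.erase j) + v j • mulNat A (Finsupp.single j 1) := by
      rw [← hnsmul, ← mulNat_add, ← hv']
    simp only [mulNat_add, hnsmul, hmul, hv2, Nat.add_sub_cancel]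
    module

/-- The linear span of a standard pair is cut out by the support functions of the facets
containing it. -/
theorem mem_span_of_forall_facet_form (hrank : (A.map (Int.cast : ℤ → ℚ)).rank = d)
    {k : Type*} [Field k] {χ : Fin d → ℤ} {u : Fin n →₀ ℕ} {τ : Finset (Fin n)}
    (hp : IsStandardPair (monIdeal A k χ) u τ) {z : Fin d → ℚ}
    (hz : ∀ (σ : PointedCone ℚ (Fin d → ℚ)) (F : (Fin d → ℚ) →ₗ[ℚ] ℚ),
      IsFacet A σ → coneOf A τ ≤ σ → IsPrimitiveSupport A σ F → F z = 0) :
    z ∈ Submodule.span ℚ (ratCol A '' τ) := by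
  obtain ⟨c, e, hc, he, heq⟩ : ∃ c e : Fin n → ℚ, (∀ j, 0 ≤ c j) ∧ (∀ j ∈ τ, 0 ≤ e j) ∧
      z = ∑ j, c j • ratCol A j - ∑ j ∈ τ, e j • ratCol A j := by
    by_contra h
    obtain ⟨σ, F, hσ, hτσ, hF, hneg⟩ := exists_facet_form_neg hrank h
    rw [hz σ F hσ hτσ hF] at hneg
    exact hneg.false
  rw [heq]
  refine sub_mem (Submodule.sum_mem _ fun j _ => ?_) (Submodule.sum_mem _ fun j hj =>
    Submodule.smul_mem _ _ (Submodule.subset_span ⟨j, hj, rfl⟩))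
  by_cases hcj : c j = 0
  · rw [hcj, zero_smul]
    exact zero_mem _
  refine Submodule.smul_mem _ _ (Submodule.subset_span ⟨j, ?_, rfl⟩)
  refine mem_of_forall_facet_form hrank hp fun σ F hσ hτσ hF => ?_
  have h0 := hz σ F hσ hτσ hF
  have hτ0 : ∑ i ∈ τ, e i • F (ratCol A i) = 0 := Finset.sum_eq_zero fun i hi => by
    rw [hF.eq_zero i (hτσ (ratCol_mem_coneOf hi)), smul_zero]
  rw [heq, map_sub, map_sum, map_sum] at h0
  simp only [map_smul] at h0
  rw [hτ0, sub_zero] at h0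
  -- `F z = 0` is a sum of nonnegative terms `c i * F (a_i)`, so each term is zero.
  have := (Finset.sum_eq_zero_iff_of_nonneg fun i _ => mul_nonneg (hc i) (hF.nonneg i)).1 h0 j
    (Finset.mem_univ j)
  exact (mul_eq_zero.1 this).resolve_left hcj

end Facets

/-! ### The components of the decomposition -/

section Components

variable {d n : ℕ} {A : Matrix (Fin d) (Fin n) ℤ} {k : Type*} [Field k]

theorem eval_formPoly (F : (Fin d → ℚ) →ₗ[ℚ] ℚ) (β : Fin d → k) :
    eval β (formPoly k F) = ∑ i, ((F (Pi.single i 1) : ℚ) : k) * β i := by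
  simp [formPoly]

theorem mulNat_mem_affinePiece (u : Fin n →₀ ℕ) (τ : Finset (Fin n)) :
    (fun i => (mulNat A u i : k)) ∈ affinePiece A k u τ :=
  ⟨0, zero_mem _, (add_zero _).symm⟩

variable [CharZero k]

theorem ratCast_mem_span {τ : Finset (Fin n)} {z : Fin d → ℚ}
    (hz : z ∈ Submodule.span ℚ (ratCol A '' τ)) :
    (fun i => (z i : k)) ∈ Submodule.span k ((fun j i => (A i j : k)) '' (τ : Set (Fin n))) := by
  induction hz using Submodule.span_induction with
  | mem z hz =>
    obtain ⟨j, hj, rfl⟩ := hz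
    exact Submodule.subset_span ⟨j, hj, by ext i; simp [ratCol]⟩
  | zero =>
    convert Submodule.zero_mem _ using 1
    ext i
    simp
  | add y z _ _ hy hz =>
    convert add_mem hy hz using 1
    ext i
    simp
  | smul r z _ hz =>
    convert Submodule.smul_mem _ (r : k) hz using 1
    ext i
    simp

theorem linSpan_eq (τ : Finset (Fin n)) :
    linSpan A k τ = Submodule.span k ((fun j i => (A i j : k)) '' (τ : Set (Fin n))) := by
  refine le_antisymm (Submodule.span_le.2 ?_) (Submodule.span_mono (Set.image_mono fun j hj =>
    ratCol_mem_coneOf hj))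
  rintro _ ⟨j, hj, rfl⟩
  simpa [ratCol] using ratCast_mem_span (k := k) (coneOf_le_span τ hj)

theorem eval_formPoly_ratCast (F : (Fin d → ℚ) →ₗ[ℚ] ℚ) (z : Fin d → ℚ) :
    eval (fun i => (z i : k)) (formPoly k F) = (F z : ℚ) := by
  have e : z = ∑ i, z i • (Pi.single i 1 : Fin d → ℚ) := by
    ext i
    simp [Finset.sum_apply, Pi.single_apply]
  rw [eval_formPoly]
  conv_rhs => rw [e, map_sum]
  simp [mul_comm]

theorem eval_formPoly_eq_zero {τ : Finset (Fin n)} {F : (Fin d → ℚ) →ₗ[ℚ] ℚ}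
    (hF : ∀ j ∈ τ, F (ratCol A j) = 0) {w : Fin d → k} (hw : w ∈ linSpan A k τ) :
    eval w (formPoly k F) = 0 := by
  rw [linSpan_eq] at hw
  induction hw using Submodule.span_induction with
  | mem w hw =>
    obtain ⟨j, hj, rfl⟩ := hw
    have := eval_formPoly_ratCast (k := k) F (ratCol A j)
    rw [hF j hj] at this
    simpa [ratCol] using this
  | zero => rw [eval_formPoly]; simp
  | add y z _ _ hy hz =>
    rw [eval_formPoly] at *
    simp only [Pi.add_apply, mul_add, Finset.sum_add_distrib, hy, hz, add_zero]
  | smul r z _ hz =>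
    rw [eval_formPoly] at *
    simp only [Pi.smul_apply, smul_eq_mul, mul_left_comm _ r, ← Finset.mul_sum, hz, mul_zero]

theorem eval_eq_zero_of_mem_componentIdeal {u : Fin n →₀ ℕ} {τ : Finset (Fin n)}
    {p : MvPolynomial (Fin d) k} (hp : p ∈ componentIdeal A k u τ) {β : Fin d → k}
    (hβ : β ∈ affinePiece A k u τ) : eval β p = 0 := by
  have h : componentIdeal A k u τ ≤ RingHom.ker (eval β) := by
    rw [componentIdeal, Ideal.span_le]
    rintro _ ⟨σ, F, -, hτσ, hF, rfl⟩
    obtain ⟨w, hw, rfl⟩ := hβ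
    rw [SetLike.mem_coe, RingHom.mem_ker, map_sub, eval_C, eval_formPoly]
    simp only [Pi.add_apply, mul_add, Finset.sum_add_distrib]
    rw [← eval_formPoly, ← eval_formPoly,
      eval_formPoly_eq_zero (fun j hj => hF.eq_zero j (hτσ (ratCol_mem_coneOf hj))) hw]
    have := eval_formPoly_ratCast (k := k) F fun i => (mulNat A u i : ℚ)
    simp only [Rat.cast_intCast] at this
    rw [this, add_zero, sub_self]
  exact h hp

/-- By duality: the common zeros of the facet forms lie in the span of `τ`, so these forms span its
whole annihilator. The polynomial `L - L(Au)` is linear in `L`. -/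
theorem formPoly_sub_mem_componentIdeal (hrank : (A.map (Int.cast : ℤ → ℚ)).rank = d)
    {χ : Fin d → ℤ} {u : Fin n →₀ ℕ} {τ : Finset (Fin n)}
    (hp : IsStandardPair (monIdeal A k χ) u τ) {L : (Fin d → ℚ) →ₗ[ℚ] ℚ}
    (hL : ∀ z ∈ Submodule.span ℚ (ratCol A '' τ), L z = 0) :
    formPoly k L - C ((L fun i => (mulNat A u i : ℚ) : ℚ) : k) ∈ componentIdeal A k u τ := by
  let S : Submodule ℚ (Module.Dual ℚ (Fin d → ℚ)) := Submodule.span ℚ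
    {F | ∃ σ, IsFacet A σ ∧ coneOf A τ ≤ σ ∧ IsPrimitiveSupport A σ F}
  have hmem : L ∈ S := by
    rw [← Subspace.dualCoannihilator_dualAnnihilator_eq (W := S), Submodule.mem_dualAnnihilator]
    intro z hz
    rw [Submodule.mem_dualCoannihilator] at hz
    exact hL z (mem_span_of_forall_facet_form hrank hp fun σ F h1 h2 h3 =>
      hz F (Submodule.subset_span ⟨σ, h1, h2, h3⟩))
  clear hL
  induction hmem using Submodule.span_induction with
  | mem F hF =>
    obtain ⟨σ, h1, h2, h3⟩ := hF
    exact Ideal.subset_span ⟨σ, F, h1, h2, h3, rfl⟩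
  | zero => simp [formPoly]
  | add F G _ _ hF hG =>
    convert add_mem hF hG using 1
    simp [formPoly, add_mul, Finset.sum_add_distrib]
    ring
  | smul r F _ hF =>
    convert Ideal.mul_mem_left _ (C (r : k)) hF using 1
    simp [formPoly, mul_sub, Finset.mul_sum, mul_assoc]

/-- Modulo the component ideal, every polynomial agrees with its pullback along a retraction
onto the affine space of the component. -/
theorem exists_retraction (hrank : (A.map (Int.cast : ℤ → ℚ)).rank = d)
    {χ : Fin d → ℤ} {u : Fin n →₀ ℕ} {τ : Finset (Fin n)}
    (hp : IsStandardPair (monIdeal A k χ) u τ) :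
    ∃ (φ : MvPolynomial (Fin d) k →ₐ[k] MvPolynomial (Fin d) k) (r : (Fin d → k) → Fin d → k),
      (∀ p, p - φ p ∈ componentIdeal A k u τ) ∧ (∀ β p, eval β (φ p) = eval (r β) p) ∧
      ∀ β, r β ∈ affinePiece A k u τ := by
  set W := Submodule.span ℚ (ratCol A '' (τ : Set (Fin n)))
  obtain ⟨g, hg⟩ := LinearMap.exists_leftInverse_of_injective W.subtype W.ker_subtype
  set P : (Fin d → ℚ) →ₗ[ℚ] (Fin d → ℚ) := W.subtype ∘ₗ g
  have hPmem (z) : P z ∈ W := (g z).2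
  have hPid (z) (hz : z ∈ W) : P z = z :=
    congrArg Subtype.val (LinearMap.congr_fun hg ⟨z, hz⟩)
  -- Substitution of `Au + P(s - Au)` for `s`, with `P` a projection onto the span of `τ`; `r` is
  -- the corresponding map of points.
  let φ : MvPolynomial (Fin d) k →ₐ[k] MvPolynomial (Fin d) k := aeval fun i =>
    C (mulNat A u i : k) + ∑ l, C ((P (Pi.single l 1) i : ℚ) : k) * (X l - C (mulNat A u l : k))
  let r : (Fin d → k) → Fin d → k := fun β => (fun i => (mulNat A u i : k)) +
    ∑ l, (β l - (mulNat A u l : k)) • fun i => ((P (Pi.single l 1) i : ℚ) : k)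
  refine ⟨φ, r, ?_, ?_, ?_⟩
  · intro p
    rw [← Ideal.Quotient.eq]
    have : (Ideal.Quotient.mkₐ k (componentIdeal A k u τ)).comp φ =
        Ideal.Quotient.mkₐ k (componentIdeal A k u τ) := by
      refine MvPolynomial.algHom_ext fun i => ?_
      rw [AlgHom.comp_apply, Ideal.Quotient.mkₐ_eq_mk, eq_comm, Ideal.Quotient.eq]
      -- The difference `s_i - φ(s_i)` is `L - L(Au)` for the `i`-th coordinate `L` of `id - P`,
      -- which vanishes on the span of `τ`.
      let L : (Fin d → ℚ) →ₗ[ℚ] ℚ := LinearMap.proj i ∘ₗ (LinearMap.id - P)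
      have hL := formPoly_sub_mem_componentIdeal hrank hp (L := L) fun z hz => by
        simp [L, hPid z hz]
      convert hL using 1
      have h2 : ((L fun i => (mulNat A u i : ℚ) : ℚ) : k) =
          ∑ l, ((L (Pi.single l 1) : ℚ) : k) * (mulNat A u l : k) := by
        rw [← eval_formPoly_ratCast, eval_formPoly]
        simp
      have hs (f : Fin d → MvPolynomial (Fin d) k) :
          ∑ l, C ((L (Pi.single l 1) : ℚ) : k) * f l =
            f i - ∑ l, C ((P (Pi.single l 1) i : ℚ) : k) * f l := by
        have : ∀ l, C ((L (Pi.single l 1) : ℚ) : k) * f l =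
            (if l = i then f l else 0) - C ((P (Pi.single l 1) i : ℚ) : k) * f l := by
          intro l
          by_cases h : l = i
          · subst h; simp [L, sub_mul]
          · simp [L, h, Ne.symm h]
        rw [Finset.sum_congr rfl fun l _ => this l, Finset.sum_sub_distrib]
        simp
      rw [formPoly, h2, map_sum]
      simp only [C_mul]
      rw [hs, hs fun l => C (mulNat A u l : k)]
      simp only [φ, aeval_X, mul_sub, Finset.sum_sub_distrib]
      ring
    exact (AlgHom.congr_fun this p).symm
  · intro β p
    have : (aeval β).comp φ = aeval (r β) := by
      refine MvPolynomial.algHom_ext fun i => ?_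
      simp [φ, r, Finset.sum_apply, mul_comm]
    exact AlgHom.congr_fun this p
  · intro β
    refine ⟨_, ?_, rfl⟩
    rw [linSpan_eq]
    exact Submodule.sum_mem _ fun l _ => Submodule.smul_mem _ _ (ratCast_mem_span (hPmem _))

theorem eq_zero_of_forall_eval {p : MvPolynomial (Fin d) k} (h : ∀ β, eval β p = 0) : p = 0 :=
  MvPolynomial.funext fun β => by rw [h, map_zero]

theorem mem_componentIdeal_iff (hrank : (A.map (Int.cast : ℤ → ℚ)).rank = d)
    {χ : Fin d → ℤ} {u : Fin n →₀ ℕ} {τ : Finset (Fin n)}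
    (hp : IsStandardPair (monIdeal A k χ) u τ) {p : MvPolynomial (Fin d) k} :
    p ∈ componentIdeal A k u τ ↔ ∀ β ∈ affinePiece A k u τ, eval β p = 0 := by
  refine ⟨fun h β hβ => eval_eq_zero_of_mem_componentIdeal h hβ, fun h => ?_⟩
  obtain ⟨φ, r, h1, h2, h3⟩ := exists_retraction hrank hp
  have h0 : φ p = 0 := eq_zero_of_forall_eval fun β => by rw [h2, h _ (h3 β)]
  simpa [h0] using h1 p

/-- The ideal is the kernel of the retraction `φ`, whose target is a domain. -/
theorem componentIdeal_isPrime (hrank : (A.map (Int.cast : ℤ → ℚ)).rank = d)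
    {χ : Fin d → ℤ} {u : Fin n →₀ ℕ} {τ : Finset (Fin n)}
    (hp : IsStandardPair (monIdeal A k χ) u τ) : (componentIdeal A k u τ).IsPrime := by
  obtain ⟨φ, r, h1, h2, h3⟩ := exists_retraction hrank hp
  have hφ {p} (h : φ p = 0) : p ∈ componentIdeal A k u τ := by simpa [h] using h1 p
  refine ⟨fun h => ?_, fun {p q} hpq => ?_⟩
  · have := eval_eq_zero_of_mem_componentIdeal (p := (1 : MvPolynomial (Fin d) k))
      (h ▸ Submodule.mem_top) (mulNat_mem_affinePiece u τ)
    simp at this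
  · have h0 : φ p * φ q = 0 := by
      rw [← map_mul]
      exact eq_zero_of_forall_eval fun β => by
        rw [h2, eval_eq_zero_of_mem_componentIdeal hpq (h3 β)]
    exact (mul_eq_zero.1 h0).imp hφ hφ

theorem zeroLocus_componentIdeal (hrank : (A.map (Int.cast : ℤ → ℚ)).rank = d)
    {χ : Fin d → ℤ} {u : Fin n →₀ ℕ} {τ : Finset (Fin n)}
    (hp : IsStandardPair (monIdeal A k χ) u τ) :
    zeroLocus k (componentIdeal A k u τ) = affinePiece A k u τ := by
  refine Set.Subset.antisymm (fun β hβ => ?_) fun β hβ p hpmem => ?_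
  · obtain ⟨φ, r, h1, h2, h3⟩ := exists_retraction hrank hp
    have : β = r β := by
      ext i
      have h : eval β (X i - φ (X i)) = 0 := hβ _ (h1 (X i))
      rw [map_sub, h2, eval_X, eval_X, sub_eq_zero] at h
      exact h
    rw [this]
    exact h3 β
  · exact eval_eq_zero_of_mem_componentIdeal hpmem hβ

theorem isZariskiIrreducible_affinePiece (hrank : (A.map (Int.cast : ℤ → ℚ)).rank = d)
    {χ : Fin d → ℤ} {u : Fin n →₀ ℕ} {τ : Finset (Fin n)}
    (hp : IsStandardPair (monIdeal A k χ) u τ) : IsZariskiIrreducible (affinePiece A k u τ) := by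
  refine ⟨⟨_, mulNat_mem_affinePiece u τ⟩, fun I J h => ?_⟩
  have hle {K : Ideal (MvPolynomial (Fin d) k)} (hK : K ≤ componentIdeal A k u τ) :
      affinePiece A k u τ ⊆ zeroLocus k K := by
    rw [← zeroLocus_componentIdeal hrank hp]
    exact zeroLocus_anti_mono hK
  refine ((componentIdeal_isPrime hrank hp).mul_le.1 ?_).imp hle hle
  rw [Ideal.mul_le]
  intro f hf g hg
  rw [mem_componentIdeal_iff hrank hp]
  intro β hβ
  rw [map_mul, mul_eq_zero]
  exact (h hβ).imp (fun h => h f hf) (fun h => h g hg)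

/-- A polynomial vanishing on the translated monoid `Au + ℕτ` vanishes on the affine space
`Au + kτ`. -/
theorem eval_eq_zero_of_mem_affinePiece {u : Fin n →₀ ℕ} {τ : Finset (Fin n)}
    {p : MvPolynomial (Fin d) k} (h : ∀ v : Fin n →₀ ℕ, v.support ⊆ τ →
      eval (fun i => (mulNat A (u + v) i : k)) p = 0)
    {β : Fin d → k} (hβ : β ∈ affinePiece A k u τ) : eval β p = 0 := by
  classical
  obtain ⟨w, hw, rfl⟩ := hβ
  rw [linSpan_eq, Submodule.mem_span_image_finset_iff_exists_fun] at hw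
  obtain ⟨t, ht⟩ := hw
  obtain ⟨t, rfl⟩ : ∃ t : Fin n → k, ∑ j ∈ τ, t j • (fun i => (A i j : k)) = w := by
    refine ⟨fun j => if h : j ∈ τ then t ⟨j, h⟩ else 0, ?_⟩
    rw [← ht, ← Finset.sum_coe_sort]
    simp
  let ψ : MvPolynomial (Fin d) k →ₐ[k] MvPolynomial (Fin n) k := aeval fun i =>
    C (mulNat A u i : k) + ∑ j ∈ τ, X j * C (A i j : k)
  have hψ (t : Fin n → k) (q : MvPolynomial (Fin d) k) : eval t (ψ q) =
      eval ((fun i => (mulNat A u i : k)) + ∑ j ∈ τ, t j • fun i => (A i j : k)) q := by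
    have : (aeval t).comp ψ =
        aeval ((fun i => (mulNat A u i : k)) + ∑ j ∈ τ, t j • fun i => (A i j : k)) := by
      refine MvPolynomial.algHom_ext fun i => ?_
      simp [ψ, Finset.sum_apply]
    exact AlgHom.congr_fun this q
  -- The pullback of `p` to the parameters `t` vanishes on the grid `ℕ^n`, which is infinite in
  -- every coordinate in characteristic zero.
  have h0 : ψ p = 0 := by
    refine MvPolynomial.funext_set (fun _ => Set.range (Nat.cast : ℕ → k))
      (fun _ => Set.infinite_range_of_injective Nat.cast_injective) fun x hx => ?_
    choose v hv using fun j => hx j (Set.mem_univ j)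
    let v' : Fin n →₀ ℕ := Finsupp.equivFunOnFinite.symm fun j => if j ∈ τ then v j else 0
    have hv' : v'.support ⊆ τ := by
      intro j hj
      by_contra hn
      simp [v', hn] at hj
    rw [hψ, map_zero, ← h v' hv']
    congr 2
    ext i
    have e : mulNat A v' i = ∑ j ∈ τ, (v j : ℤ) * A i j := by
      simp [mulNat, Matrix.mulVec, dotProduct, v', mul_comm]
    simp [mulNat_add, e, Finset.sum_apply, ← hv]
  rw [← hψ, h0, map_zero]

end Components

theorem theorem4p6 {k : Type*} [Field k] [CharZero k] {d n : ℕ}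
    (A : Matrix (Fin d) (Fin n) ℤ)
    (hrank : (A.map (Int.cast : ℤ → ℚ)).rank = d)
    (hplane : ∃ h : Fin d → ℚ, ∀ j, ∑ i, h i * (A i j : ℚ) = 1)
    (χ : Fin d → ℤ) (hχ : χ ∈ intSpan A) :
    -- the prime decomposition of the `b`-ideal
    ((standardPairs (monIdeal A k χ)).Finite ∧
      (∀ p ∈ standardPairs (monIdeal A k χ), (componentIdeal A k p.1 p.2).IsPrime) ∧
      bIdeal A k χ = ⨅ p ∈ standardPairs (monIdeal A k χ), componentIdeal A k p.1 p.2) ∧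
    -- the irreducible decomposition of its zero set
    (zeroLocus k (bIdeal A k χ) =
        ⋃ p ∈ standardPairs (monIdeal A k χ), affinePiece A k p.1 p.2 ∧
      ∀ p ∈ standardPairs (monIdeal A k χ), IsZariskiIrreducible (affinePiece A k p.1 p.2)) := by
  have hfin := standardPairs_finite (monIdeal A k χ)
  have hB : bIdeal A k χ = ⨅ p ∈ standardPairs (monIdeal A k χ), componentIdeal A k p.1 p.2 := by
    ext f
    rw [WeylAlgebra.mem_bIdeal_iff k hplane]
    simp only [Submodule.mem_iInf]
    constructor
    · intro h p hp
      rw [mem_componentIdeal_iff hrank hp]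
      exact fun β hβ => eval_eq_zero_of_mem_affinePiece (fun v hv => h _ (hp.notMem v hv)) hβ
    · intro h u hu
      obtain ⟨p, hp, v, hv, rfl⟩ := exists_standardPair_of_notMem hu
      refine eval_eq_zero_of_mem_componentIdeal (h p hp) ⟨fun i => (mulNat A v i : k), ?_, ?_⟩
      · rw [linSpan_eq]
        have : (fun i => (mulNat A v i : k)) = ∑ j ∈ p.2, (v j : k) • fun i => (A i j : k) := by
          ext i
          rw [Finset.sum_subset (Finset.subset_univ p.2) fun j _ hj => by
            rw [Finsupp.notMem_support_iff.1 fun h => hj (hv h), Nat.cast_zero, zero_smul]]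
          simp [mulNat, Matrix.mulVec, dotProduct, Finset.sum_apply, mul_comm]
        rw [this]
        exact Submodule.sum_mem _ fun j hj =>
          Submodule.smul_mem _ _ (Submodule.subset_span ⟨j, hj, rfl⟩)
      · ext i
        simp [mulNat_add]
  refine ⟨⟨hfin, fun p hp => componentIdeal_isPrime hrank hp, hB⟩, ?_,
    fun p hp => isZariskiIrreducible_affinePiece hrank hp⟩
  refine Set.Subset.antisymm (fun β hβ => ?_) ?_
  · by_contra hn
    simp only [Set.mem_iUnion, not_exists] at hn
    -- A point off every piece has, for each pair, a polynomial of the component ideal that is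
    -- nonzero there. The product over the finitely many pairs lies in `B_χ` and is nonzero at the
    -- point.
    have hex : ∀ p ∈ standardPairs (monIdeal A k χ),
        ∃ f ∈ componentIdeal A k p.1 p.2, eval β f ≠ 0 := by
      intro p hp
      by_contra! h
      refine hn p hp ?_
      rw [← zeroLocus_componentIdeal hrank hp]
      exact h
    choose! f hf hfβ using hex
    have hprod : ∏ p ∈ hfin.toFinset, f p ∈ bIdeal A k χ := by
      rw [hB]
      simp only [Submodule.mem_iInf]
      intro p hp
      have hp' : p ∈ hfin.toFinset := hfin.mem_toFinset.2 hp
      exact Ideal.mem_of_dvd _ (Finset.dvd_prod_of_mem f hp') (hf p hp)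
    have h0 : eval β (∏ p ∈ hfin.toFinset, f p) = 0 := hβ _ hprod
    rw [map_prod, Finset.prod_eq_zero_iff] at h0
    obtain ⟨p, hp, h0⟩ := h0
    exact hfβ p (hfin.mem_toFinset.1 hp) h0
  · refine Set.iUnion₂_subset fun p hp => ?_
    rw [← zeroLocus_componentIdeal hrank hp, hB]
    exact zeroLocus_anti_mono (iInf₂_le p hp)
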